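/- **Setting.** Let $\Theta\subseteq\mathbb R^q$, $\mathbb B\subseteq\mathbb R^p$. For sample size $n$ let $u\sim F_u$ and $u_{\rm DP}\sim F_{\rm DP}$ be independent seeds with known laws (which may depend on $n$), $D=G(\theta,u)$ the data generated at $\theta\in\Theta$, and let the statistic $s=s(D,u_{\rm DP})\in\arg\min_{\beta\in\mathbb B}\rho_n(\beta;D,u_{\rm DP})$ be measurable. Write $s(\theta)$ for the statistic observed when the true parameter is $\theta$, $s=s(\theta^*)$, and $s^r(\theta)$, $r\ge1$, for the statistics simulated at $\theta$ from i.i.d. seeds $(u^r,u^r_{\rm DP})$ that are independent of the seeds of the observed data and do not depend on $\theta$. Let $m^R(\theta)$ and $S^R(\theta)$ be the sample mean and sample covariance matrix (divisor $R-1$) of $s^1(\theta),\dots,s^R(\theta)$, and $\|a\|_\Omega:=a^\top\Omega a$. The adaptive indirect estimator $\hat\theta_{\rm ADI}(s,u^{[R]},u_{\rm DP}^{[R]})$ is a measurable minimizer over $\theta\in\Theta$ of $\|s-m^{R}(\theta)\|_{S^{R}(\theta)^{-1}}$ (read as $+\infty$ where $S^R(\theta)$ is singular); the indirect estimator $\hat\theta_{\rm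 IND}$ is a measurable minimizer of $\|s-m^{R}(\theta)\|_{\Omega_n}$ for given matrices $\Omega_n$. Fix $\theta^*\in\Theta$ and integers $R_n\to\infty$; $\hat\theta_{\rm ADI}$ uses $R=R_n$. **Assumptions** (random sequences converge in probability unless stated otherwise). * (A1) There is a non-random $\rho_\infty(\beta;\theta^*)$, continuous in $\beta\in\mathbb B$, with $\sup_{\beta\in\mathbb B}|\rho_n(\beta;D,u_{\rm DP})-\rho_\infty(\beta;\theta^*)|\to0$, where $D=G(\theta^*,u)$. * (A2) For each $\theta\in\Theta$, $b(\theta)\in\mathbb B$ is the unique minimizer of $\rho_\infty(\cdot;\theta)$ over $\mathbb B$; $\beta^*:=b(\theta^*)$ and all values of the statistic are interior points of $\mathbb B$; $b$ is continuous and injective on $\Theta$, its inverse is continuous at $\beta^*$ (that is, $\inf_{\theta\in\Theta,\|\theta-\theta^*\|\ge\varepsilon}\|b(\theta)-\beta^*\|>0$ for all $\varepsilon>0$); the Jacobian $\partial b/\partial\theta^\top$ exists and has full column rank on the interior of $\Theta$. * (A3) $\sup_{\theta\in\Theta}\|s^r(\theta)-b(\theta)\|\to0$. * (A5) $\theta^*$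 is an interior point of $\Theta$. On the interior of $\Theta$, $s^r(\theta)$ (for all seeds) and $b(\theta)$ are continuously differentiable and $\partial s^r(\theta)/\partial\theta\to\partial b(\theta)/\partial\theta$ for each $\theta$; moreover $\partial s^r(\theta_n)/\partial\theta\to B^*:=\partial b(\theta^*)/\partial\theta$ for all random $\theta_n\to\theta^*$. * (A6) $\rho_n$ is continuously differentiable in $\beta$ on the interior of $\mathbb B$, and $-\sqrt n\,\partial\rho_n(\beta^*;D,u_{\rm DP})/\partial\beta$ converges in distribution to a law $F^*$. * (A7) $\rho_n$ is twice continuously differentiable in $\beta$ on the interior of $\mathbb B$; the Hessian matrix $J^*$ of $\rho_\infty(\cdot;\theta^*)$ at $\beta^*$ exists and is nonsingular, and $\partial^2\rho_n(\beta_n;D,u_{\rm DP})/\partial\beta\partial\beta^\top\to J^*$ for all random $\beta_n\to\beta^*$ (in particular for $\beta_n=\beta^*$). * (A8) For each $\theta\in\Theta$, $\sqrt n(s^r(\theta)-b(\theta))$ is square integrable for large $n$ and converges in distribution, and its covariance matrix converges to the (finite) covariance matrix $\Sigma(\theta)\succ0$ of the limit; $\Sigma$ is continuous on $\Theta$; $\sqrt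 n(m^{R_n}(\theta^*)-\beta^*)\to0$; and $m^{R_n}(\theta)\to b(\theta)$, $nS^{R_n}(\theta)\to\Sigma(\theta)$ uniformly in $\theta\in\Theta$. * (A9) All values of $\hat\theta_{\rm ADI}$ (for every $s\in\mathbb B$ and all seeds) are interior points of $\Theta$, and for all random $\theta_n\to\theta^*$, $\partial m^{R_n}(\theta_n)/\partial\theta\to B^*$ and $\partial(nS^{R_n}(\theta_n))/\partial\theta=O_p(1)$. **Theorem.** Let $v\sim F^*$ and $\Omega^*:=\Sigma(\theta^*)^{-1}$. 1. Under (A1–A3, A6–A8), $\hat\theta_{\rm ADI}\to\theta^*$ in probability. Under (A1–A3, A5–A9): 2. $(J^*)^{-1}v$ is square integrable, $\Omega^*=\mathrm{Var}[(J^*)^{-1}v]^{-1}$, and $\sqrt n(\hat\theta_{\rm ADI}-\theta^*)$ converges in distribution to $((B^*)^\top\Omega^*B^*)^{-1}(B^*)^\top\Omega^*(J^*)^{-1}v$. 3. $\hat\theta_{\rm ADI}$ and $s$ are asymptotically equivariant at $\theta^*$: for all convergent sequences $h_n\to h$ with $\theta_n:=\theta^*+h_n/\sqrt n\in\Theta$,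 when the true parameter is $\theta_n$ the laws of $\sqrt n(\hat\theta_{\rm ADI}-\theta_n)$ and of $\sqrt n(s(\theta_n)-b(\theta_n))$ converge weakly to limits that do not depend on $(h_n)$. 4. The covariance matrix of the limit in 2 is $\Lambda:=((B^*)^\top\Sigma(\theta^*)^{-1}B^*)^{-1}$. It is minimal in the Loewner order: (a) if $\psi:\mathbb R^p\to\mathbb R^q$ is measurable, continuously differentiable at $\beta^*$ and consistent, i.e. $\psi(s(\theta))\to\theta$ in probability for every $\theta\in\Theta$, then $\sqrt n(\psi(s)-\theta^*)$ converges in distribution to a limit whose covariance matrix is finite and $\succeq\Lambda$; (b) if $R\ge1$ is fixed, $\Omega_n$ are deterministic positive definite matrices converging to a positive definite matrix, and $\hat\theta_{\rm IND}$ (with these $R$, $\Omega_n$) takes all its values (for every $s\in\mathbb B$ and all seeds) in the interior of $\Theta$, then $\sqrt n(\hat\theta_{\rm IND}-\theta^*)$ converges in distribution to a limit whose covariance matrix is finite and $\succeq\Lambda$. -/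

import Mathlib

open MeasureTheory ProbabilityTheory Filter Topology
open scoped Matrix

universe u₁ u₂ u₃ u₄

noncomputable section

namespace IndirectInference

/-- Column vectors of length `k` with the Euclidean norm. -/
abbrev E (k : ℕ) : Type := EuclideanSpace ℝ (Fin k)

/-! ### Vectors, matrices and derivatives -/

/-- The Jacobian matrix `∂f/∂xᵀ`, with `(i, j)` entry `∂fᵢ/∂xⱼ`. -/
def jacobian {p q : ℕ} (f : E q → E p) (x : E q) : Matrix (Fin p) (Fin q) ℝ :=
  Matrix.of fun i j => (fderiv ℝ f x (EuclideanSpace.single j 1)) i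

/-- The Hessian matrix `∂²f/(∂x ∂xᵀ)`, i.e. the Jacobian matrix of the gradient. -/
def hessian {p : ℕ} (f : E p → ℝ) (x : E p) : Matrix (Fin p) (Fin p) ℝ :=
  jacobian (fun y => gradient f y) x

/-- The quadratic form `‖a‖_W = aᵀ W a`. -/
def wnorm {p : ℕ} (W : Matrix (Fin p) (Fin p) ℝ) (a : E p) : ℝ :=
  a.ofLp ⬝ᵥ (W *ᵥ a.ofLp)

/-- The matrix-vector product `A v` between Euclidean spaces. -/
def act {p q : ℕ} (A : Matrix (Fin q) (Fin p) ℝ) (v : E p) : E q :=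
  WithLp.toLp 2 (A *ᵥ v.ofLp)

/-- The weighted least squares matrix `(Bᵀ W B)⁻¹ Bᵀ W`. -/
def wls {p q : ℕ} (B : Matrix (Fin p) (Fin q) ℝ) (W : Matrix (Fin p) (Fin p) ℝ) :
    Matrix (Fin q) (Fin p) ℝ :=
  (Bᵀ * W * B)⁻¹ * Bᵀ * W

/-- Sample mean `(1/R) ∑ᵣ zʳ`. -/
def sampleMean {p R : ℕ} (z : Fin R → E p) : E p := (R : ℝ)⁻¹ • ∑ r, z r

/-- Sample covariance matrix `(1/(R-1)) ∑ᵣ (zʳ - z̄)(zʳ - z̄)ᵀ`. -/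
def sampleCov {p R : ℕ} (z : Fin R → E p) : Matrix (Fin p) (Fin p) ℝ :=
  Matrix.of fun i j =>
    ((R : ℝ) - 1)⁻¹ * ∑ r, (z r i - sampleMean z i) * (z r j - sampleMean z j)

/-! ### Probabilistic notions -/

/-- The covariance matrix `Var(X)` of a random vector `X` under `P`
(meaningful for square integrable `X`). -/
def covMat {Ω : Type*} [MeasurableSpace Ω] {p : ℕ} (X : Ω → E p) (P : Measure Ω) :
    Matrix (Fin p) (Fin p) ℝ :=
  Matrix.of fun i j => cov[fun ω => X ω i, fun ω => X ω j; P]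

/-- `sup_{a ∈ A} dist (Xₙ(a), X(a)) → 0` in (outer) probability. -/
def UniformlyInProb {Ω α F : Type*} [MeasurableSpace Ω] [PseudoMetricSpace F] (P : Measure Ω)
    (A : Set α) (X : ℕ → Ω → α → F) (X₀ : α → F) : Prop :=
  ∀ ε : ℝ, 0 < ε →
    Tendsto (fun n => P {ω | ∃ a ∈ A, ε ≤ dist (X n ω a) (X₀ a)}) atTop (𝓝 0)

/-- `Xₙ = O_p(1)`. -/
def BoundedInProb {Ω F : Type*} [MeasurableSpace Ω] [Norm F] (P : Measure Ω)
    (X : ℕ → Ω → F) : Prop :=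
  ∀ ε : ENNReal, 0 < ε → ∃ C : ℝ, ∀ᶠ n in atTop, P {ω | C < ‖X n ω‖} ≤ ε

/-- Convergence in probability to a constant. -/
def ToInProb {Ω F : Type*} [MeasurableSpace Ω] [PseudoEMetricSpace F] (P : Measure Ω)
    (X : ℕ → Ω → F) (c : F) : Prop :=
  TendstoInMeasure P X atTop (fun _ => c)

/-! ### The statistical model -/

/-- The data generating equation and the released statistic.  For sample size `n` the data are
`D = G n θ u` with seed `u ∼ Fu n`, the privacy noise is `w ∼ FDP n`, and the released statistic
`stat n D w` minimizes the criterion `β ↦ ρ n β D w` over `𝔹`. -/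
structure Model (p q : ℕ) where
  U : ℕ → Type u₁
  W : ℕ → Type u₂
  Data : ℕ → Type u₃
  [mU : ∀ n, MeasurableSpace (U n)]
  [mW : ∀ n, MeasurableSpace (W n)]
  [mData : ∀ n, MeasurableSpace (Data n)]
  Fu : ∀ n, Measure (U n)
  FDP : ∀ n, Measure (W n)
  [probFu : ∀ n, IsProbabilityMeasure (Fu n)]
  [probFDP : ∀ n, IsProbabilityMeasure (FDP n)]
  /-- the parameter space -/
  Θ : Set (E q)
  /-- the space of the statistic -/
  𝔹 : Set (E p)
  G : ∀ n, E q → U n → Data n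
  measurable_G : ∀ n, ∀ θ ∈ Θ, Measurable (G n θ)
  ρ : ∀ n, E p → Data n → W n → ℝ
  stat : ∀ n, Data n → W n → E p
  measurable_stat : ∀ n, Measurable (fun x : Data n × W n => stat n x.1 x.2)
  stat_mem : ∀ n d w, stat n d w ∈ 𝔹
  stat_min : ∀ n d w, IsMinOn (fun β => ρ n β d w) 𝔹 (stat n d w)

attribute [instance] Model.mU Model.mW Model.mData Model.probFu Model.probFDP

namespace Model

variable {p q : ℕ} (M : Model.{u₁, u₂, u₃} p q)

/-- The seeds `(u, w)` of one data set of size `n` together with its privacy noise. -/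
abbrev Seed (n : ℕ) : Type _ := M.U n × M.W n

/-- The statistic at parameter `θ` generated from the seeds `x = (u, w)`. -/
def s (n : ℕ) (x : M.Seed n) (θ : E q) : E p := M.stat n (M.G n θ x.1) x.2

/-- The mean `m^R(θ)` of the `R` simulated statistics. -/
def m (n : ℕ) {R : ℕ} (x : Fin R → M.Seed n) (θ : E q) : E p :=
  sampleMean fun r => M.s n (x r) θ

/-- The sample covariance matrix `S^R(θ)` of the `R` simulated statistics. -/
def S (n : ℕ) {R : ℕ} (x : Fin R → M.Seed n) (θ : E q) : Matrix (Fin p) (Fin p) ℝ :=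
  sampleCov fun r => M.s n (x r) θ

/-- The random seeds on a probability space: for each `n` the pairs `(u, w)` are i.i.d. with law
`Fu n ⊗ FDP n`.  Index `0` belongs to the observed data, the indices `1, 2, …` to the simulated
data sets. -/
structure Sampling {Ω : Type u₄} [MeasurableSpace Ω] (P : Measure Ω) where
  seed : ∀ n, ℕ → Ω → M.Seed n
  measurable_seed : ∀ n r, Measurable (seed n r)
  law_seed : ∀ n r, P.map (seed n r) = (M.Fu n).prod (M.FDP n)
  indep_seed : ∀ n, iIndepFun (seed n) P

/-- The objective `‖s - m^R(θ)‖` weighted by `S^R(θ)⁻¹`; it is `+∞` where `S^R(θ)` is singular. -/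
def adiObjective (n : ℕ) {R : ℕ} (s : E p) (x : Fin R → M.Seed n) (θ : E q) : EReal :=
  open Classical in
  if IsUnit (M.S n x θ).det then ((wnorm (M.S n x θ)⁻¹ (s - M.m n x θ) : ℝ) : EReal) else ⊤

/-- `est` is the adaptive indirect estimator `θ̂_ADI(s, u^{[Rₙ]}, w^{[Rₙ]})`: a measurable
selection of minimizers over `Θ` of the adaptively weighted objective. -/
structure IsADI (R : ℕ → ℕ) (est : ∀ n, E p → (Fin (R n) → M.Seed n) → E q) : Prop where
  measurable : ∀ n, Measurable fun y : E p × (Fin (R n) → M.Seed n) => est n y.1 y.2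
  mem : ∀ n, ∀ s ∈ M.𝔹, ∀ x, est n s x ∈ M.Θ
  isMin : ∀ n, ∀ s ∈ M.𝔹, ∀ x, IsMinOn (M.adiObjective n s x) M.Θ (est n s x)

/-- `est` is the indirect estimator `θ̂_IND(s, u^{[R]}, w^{[R]})` with `R` simulated data sets and
weight matrices `Wt n`. -/
structure IsIND (R : ℕ) (Wt : ℕ → Matrix (Fin p) (Fin p) ℝ)
    (est : ∀ n, E p → (Fin R → M.Seed n) → E q) : Prop where
  measurable : ∀ n, Measurable fun y : E p × (Fin R → M.Seed n) => est n y.1 y.2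
  mem : ∀ n, ∀ s ∈ M.𝔹, ∀ x, est n s x ∈ M.Θ
  isMin : ∀ n, ∀ s ∈ M.𝔹, ∀ x,
    IsMinOn (fun θ => wnorm (Wt n) (s - M.m n x θ)) M.Θ (est n s x)

/-- Every value of the estimator is an interior point of `Θ`. -/
def InteriorValued {R : ℕ → ℕ} (est : ∀ n, E p → (Fin (R n) → M.Seed n) → E q) : Prop :=
  ∀ n, ∀ s ∈ M.𝔹, ∀ x, est n s x ∈ interior M.Θ

end Model

section Sampling

variable {p q : ℕ} {M : Model.{u₁, u₂, u₃} p q} {Ω : Type u₄} [MeasurableSpace Ω]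
  {P : Measure Ω} (𝒮 : M.Sampling P)

namespace Model.Sampling

/-- The statistic `sʳ(θ)`; for `r = 0` this is the observed statistic when `θ` is the true
parameter. -/
def sr (r n : ℕ) (ω : Ω) (θ : E q) : E p := M.s n (𝒮.seed n r ω) θ

/-- The observed statistic under the true parameter `θ`. -/
def obs (n : ℕ) (ω : Ω) (θ : E q) : E p := 𝒮.sr 0 n ω θ

/-- The seeds of the `R` simulated data sets. -/
def sim (R n : ℕ) (ω : Ω) : Fin R → M.Seed n := fun r => 𝒮.seed n (r + 1) ω

/-- The random function `m^R`. -/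
def mR (R n : ℕ) (ω : Ω) (θ : E q) : E p := M.m n (𝒮.sim R n ω) θ

/-- The random function `n S^R`. -/
def nSR (R n : ℕ) (ω : Ω) (θ : E q) : Matrix (Fin p) (Fin p) ℝ :=
  (n : ℝ) • M.S n (𝒮.sim R n ω) θ

/-- An estimator evaluated at the observed statistic under the true parameter `θ` and at the
simulation seeds. -/
def eval {R : ℕ → ℕ} (est : ∀ n, E p → (Fin (R n) → M.Seed n) → E q)
    (n : ℕ) (ω : Ω) (θ : E q) : E q :=
  est n (𝒮.obs n ω θ) (𝒮.sim (R n) n ω)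

end Model.Sampling

/-! ### The assumptions

`θs` is the true parameter, `ρinf β θ` the limiting criterion, `b` the binding function. -/

/-- (A1) The criterion converges uniformly on `𝔹`, in probability, to a non-random continuous
limit. -/
structure A1 (θs : E q) (ρinf : E p → E q → ℝ) : Prop where
  continuousOn : ContinuousOn (fun β => ρinf β θs) M.𝔹
  tendsto : UniformlyInProb P M.𝔹
    (fun n ω β => M.ρ n β (M.G n θs (𝒮.seed n 0 ω).1) (𝒮.seed n 0 ω).2) (fun β => ρinf β θs)

/-- (A2) Identifiability: `b θ` is the unique minimizer of `ρinf · θ`, the binding function `b` is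
continuous and injective with an inverse that is continuous at `b θs`, and its Jacobian matrix has
full column rank; `b θs` and all values of the statistic are interior points of `𝔹`. -/
structure A2 (M : Model.{u₁, u₂, u₃} p q) (θs : E q) (ρinf : E p → E q → ℝ) (b : E q → E p) :
    Prop where
  b_mem : ∀ θ ∈ M.Θ, b θ ∈ M.𝔹
  b_min : ∀ θ ∈ M.Θ, ∀ β ∈ M.𝔹, β ≠ b θ → ρinf (b θ) θ < ρinf β θ
  b_interior : b θs ∈ interior M.𝔹
  stat_interior : ∀ n d w, M.stat n d w ∈ interior M.𝔹
  continuousOn : ContinuousOn b M.Θ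
  injOn : Set.InjOn b M.Θ
  inverse_continuous : ∀ ε : ℝ, 0 < ε → ∃ δ : ℝ, 0 < δ ∧
    ∀ θ ∈ M.Θ, ε ≤ ‖θ - θs‖ → δ ≤ ‖b θ - b θs‖
  differentiableAt : ∀ θ ∈ interior M.Θ, DifferentiableAt ℝ b θ
  rank_jacobian : ∀ θ ∈ interior M.Θ, (jacobian b θ).rank = q

/-- (A3) `sup_{θ ∈ Θ} ‖sʳ(θ) - b(θ)‖ → 0` in probability. -/
def A3 (b : E q → E p) : Prop := ∀ r, UniformlyInProb P M.Θ (𝒮.sr r) b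

/-- (A4) Deterministic positive definite weights converging to a positive definite matrix. -/
structure A4 (Wt : ℕ → Matrix (Fin p) (Fin p) ℝ) (W : Matrix (Fin p) (Fin p) ℝ) : Prop where
  posDef : ∀ n, (Wt n).PosDef
  posDef_lim : W.PosDef
  tendsto : Tendsto Wt atTop (𝓝 W)

/-- (A5) `sʳ` and `b` are continuously differentiable in `θ`, and the derivative of `sʳ` converges
in probability to that of `b`: at each fixed `θ`, and at the true parameter also along all random
sequences `θₙ → θs` in probability. -/
structure A5 (θs : E q) (b : E q → E p) : Prop where
  mem_interior : θs ∈ interior M.Θ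
  contDiffOn_s : ∀ n x, ContDiffOn ℝ 1 (M.s n x) (interior M.Θ)
  contDiffOn_b : ContDiffOn ℝ 1 b (interior M.Θ)
  tendsto : ∀ r, ∀ θ ∈ interior M.Θ,
    ToInProb P (fun n ω => fderiv ℝ (𝒮.sr r n ω) θ) (fderiv ℝ b θ)
  tendsto_local : ∀ r, ∀ θn : ℕ → Ω → E q, ToInProb P θn θs →
    ToInProb P (fun n ω => fderiv ℝ (𝒮.sr r n ω) (θn n ω)) (fderiv ℝ b θs)

/-- (A6) The criterion is continuously differentiable in `β`, and its scaled negative gradient at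
`βs` converges in distribution to `F`. -/
structure A6 [IsProbabilityMeasure P] (θs : E q) (βs : E p) (F : Measure (E p))
    [IsProbabilityMeasure F] : Prop where
  contDiffOn : ∀ n d w, ContDiffOn ℝ 1 (fun β => M.ρ n β d w) (interior M.𝔹)
  tendsto : TendstoInDistribution
    (fun (n : ℕ) ω => √(n : ℝ) • (-gradient
      (fun β => M.ρ n β (M.G n θs (𝒮.seed n 0 ω).1) (𝒮.seed n 0 ω).2) βs))
    atTop (id : E p → E p) (fun _ => P) F

/-- (A7) The criterion is twice continuously differentiable in `β`; its Hessian matrix at `βs`, and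
along all random sequences `βₙ → βs` in probability, converges in probability to the Hessian matrix
of the limiting criterion at `βs`, which is nonsingular. -/
structure A7 (θs : E q) (ρinf : E p → E q → ℝ) (βs : E p) : Prop where
  contDiffOn : ∀ n d w, ContDiffOn ℝ 2 (fun β => M.ρ n β d w) (interior M.𝔹)
  differentiable_inf : ∀ᶠ β in 𝓝 βs, DifferentiableAt ℝ (fun β => ρinf β θs) β
  twice_differentiable_inf : DifferentiableAt ℝ (fun β => gradient (fun β => ρinf β θs) β) βs
  isUnit : IsUnit (hessian (fun β => ρinf β θs) βs).det
  tendsto_local : ∀ βn : ℕ → Ω → E p, ToInProb P βn βs → ∀ i j,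
    ToInProb P
      (fun n ω => hessian (fun β => M.ρ n β (M.G n θs (𝒮.seed n 0 ω).1) (𝒮.seed n 0 ω).2)
        (βn n ω) i j)
      (hessian (fun β => ρinf β θs) βs i j)

/-- (A8) `√n (sʳ(θ) - b(θ))` converges in distribution, its covariance matrix converges to the
covariance matrix `Sig θ` of the limit, `Sig` is positive definite and continuous; moreover
`√n (m^{Rₙ}(θs) - b(θs)) → 0`, and `m^{Rₙ} → b`, `n S^{Rₙ} → Sig` uniformly on `Θ`, all in
probability. -/
structure A8 [IsProbabilityMeasure P] (R : ℕ → ℕ) (θs : E q) (b : E q → E p)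
    (Sig : E q → Matrix (Fin p) (Fin p) ℝ) : Prop where
  limit : ∀ r, ∀ θ ∈ M.Θ, ∃ L : Measure (E p), ∃ _ : IsProbabilityMeasure L,
    TendstoInDistribution (fun (n : ℕ) ω => √(n : ℝ) • (𝒮.sr r n ω θ - b θ))
      atTop (id : E p → E p) (fun _ => P) L ∧
    MemLp (id : E p → E p) 2 L ∧ covMat id L = Sig θ
  memLp : ∀ r, ∀ θ ∈ M.Θ, ∀ᶠ n in atTop, MemLp (fun ω => 𝒮.sr r n ω θ) 2 P
  tendsto_cov : ∀ r, ∀ θ ∈ M.Θ,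
    Tendsto (fun n : ℕ => covMat (fun ω => √(n : ℝ) • (𝒮.sr r n ω θ - b θ)) P) atTop (𝓝 (Sig θ))
  posDef : ∀ θ ∈ M.Θ, (Sig θ).PosDef
  continuousOn : ContinuousOn Sig M.Θ
  mean_star : ToInProb P (fun (n : ℕ) ω => √(n : ℝ) • (𝒮.mR (R n) n ω θs - b θs)) 0
  mean_unif : UniformlyInProb P M.Θ (fun n => 𝒮.mR (R n) n) b
  cov_unif : ∀ i j,
    UniformlyInProb P M.Θ (fun n ω θ => 𝒮.nSR (R n) n ω θ i j) (fun θ => Sig θ i j)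

/-- (A9) The adaptive indirect estimator takes values in the interior of `Θ`, and for every random
sequence `θₙ → θs` in probability `∂m^{Rₙ}(θₙ)/∂θ → ∂b(θs)/∂θ` in probability and
`∂(n S^{Rₙ}(θₙ))/∂θ = O_p(1)`. -/
structure A9 (R : ℕ → ℕ) (θs : E q) (b : E q → E p)
    (est : ∀ n, E p → (Fin (R n) → M.Seed n) → E q) : Prop where
  interiorValued : M.InteriorValued est
  mean_deriv : ∀ θn : ℕ → Ω → E q, ToInProb P θn θs →
    ToInProb P (fun n ω => fderiv ℝ (𝒮.mR (R n) n ω) (θn n ω)) (fderiv ℝ b θs)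
  cov_deriv : ∀ θn : ℕ → Ω → E q, ToInProb P θn θs → ∀ i j,
    BoundedInProb P (fun n ω => fderiv ℝ (fun θ => 𝒮.nSR (R n) n ω θ i j) (θn n ω))

/-! ### Notions in the conclusion -/

/-- Asymptotic equivariance at `θs` of an estimator `X` of `τ`, where `X n ω θ` is the estimator
when `θ` is the true parameter: the law of `√n (X - τ(θₙ))` under `θₙ = θs + hₙ/√n` has one and the
same limit for all convergent sequences `hₙ`. -/
def AsymptoticallyEquivariant [IsProbabilityMeasure P] (Θ : Set (E q)) (θs : E q) {k : ℕ}
    (X : ℕ → Ω → E q → E k) (τ : E q → E k) : Prop :=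
  ∃ H : Measure (E k), ∃ _ : IsProbabilityMeasure H,
    ∀ (h : ℕ → E q) (h₀ : E q), Tendsto h atTop (𝓝 h₀) →
      (∀ n : ℕ, θs + (√(n : ℝ))⁻¹ • h n ∈ Θ) →
      TendstoInDistribution
        (fun (n : ℕ) ω => √(n : ℝ) •
          (X n ω (θs + (√(n : ℝ))⁻¹ • h n) - τ (θs + (√(n : ℝ))⁻¹ • h n)))
        atTop (id : E k → E k) (fun _ => P) H

/-- `ψ(s)` is a well-behaved consistent estimator of `θ`: `ψ` is continuously differentiable at
`βs`, and `ψ(s) → θ` in probability whatever the true parameter `θ ∈ Θ`. -/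
structure WellBehaved (βs : E p) (ψ : E p → E q) : Prop where
  measurable : Measurable ψ
  contDiffAt : ContDiffAt ℝ 1 ψ βs
  consistent : ∀ θ ∈ M.Θ, ToInProb P (fun n ω => ψ (𝒮.obs n ω θ)) θ

/-- `Zₙ` converges in distribution to a square integrable limit whose covariance matrix is at least
`Λ` in the Loewner order. -/
def LimitVarianceGE [IsProbabilityMeasure P] (Z : ℕ → Ω → E q) (Λ : Matrix (Fin q) (Fin q) ℝ) :
    Prop :=
  ∃ L : Measure (E q), ∃ _ : IsProbabilityMeasure L,
    TendstoInDistribution Z atTop (id : E q → E q) (fun _ => P) L ∧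
    MemLp (id : E q → E q) 2 L ∧ (covMat id L - Λ).PosSemidef

end Sampling

end IndirectInference

end

open IndirectInference

/-!
The events that hold with probability tending to one form a filter `inProb P` on `ℕ × Ω`, and
convergence in probability, to a constant or along a random sequence of parameters, is convergence
along that filter.  The stochastic orders `o_p(1)` and `O_p(1)` become statements about `Tendsto`
and `IsOp` for which no measurability is needed.

*Consistency.*  An estimator `t` obtained by minimizing a distance between the statistic `s` and
the simulated mean `m(θ)` is consistent as soon as `‖s - m(t)‖ ≤ C ‖s - m(θs)‖` with a constant
`C`, because `m` is uniformly close to the binding function `b`, whose inverse is continuous at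
`b θs` (`tendsto_of_minimum_distance`).  For the adaptive estimator this residual bound
(`exists_adi_residual_le`) requires the weights `(n S^R(θ))⁻¹` to be bounded below uniformly in
`θ ∈ Θ`, that is, `Sig` to be bounded on the possibly noncompact `Θ`.  Boundedness is not an
assumption; it follows from the uniform convergence of `s`, `m^R` and `n S^R` in `A3` and `A8`, by
an argument on sums of independent null sequences (`eq_zero_of_tendsto_sum`, `exists_trace_le`).

*Linearization.*  The statistic is an interior minimizer, so the gradient of the criterion
vanishes there, and `√n (s - b θs)` is asymptotically the image under `J⁻¹` of the scaled negative
gradient at `b θs` (`statistic_linearization`).  The estimators are interior minimizers as well.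
In the first order condition of the adaptive one, the derivative of the weight enters
quadratically in the residual and is negligible (`score_of_isLocalMin`, `tendsto_score_of_foc`);
hence both estimators are asymptotically the weighted least squares transform `(Bᵀ W B)⁻¹ Bᵀ W` of
the statistic (`adi_linearization`, `ind_linearization`), with `W = (Sig θs)⁻¹` in the adaptive
case.  The same expansion at `θs + h n / √n` gives equivariance, since the shift of the statistic
is `B h / √n + o(1 / √n)` and the transform is a left inverse of `B`.

*Efficiency.*  A consistent `ψ(s)` satisfies `ψ ∘ b = id` near `θs`, so its Jacobian matrix is
again a left inverse of `B` (`WellBehaved.jacobian_mul`).  All the competitors are thus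
asymptotically of the form `D X` with `D B = 1`, where `X` has limiting covariance matrix
`κ Sig θs` with `κ = 1`, or `κ = 1 + 1 / R` for the indirect estimator with `R` simulations, and the
Gauss–Markov inequality applies (`limitVarianceGE_of_linear`).
-/

noncomputable section

namespace IndirectInference

/-! ### Convergence in probability as convergence along a filter -/

section InProb

variable {Ω : Type*} [MeasurableSpace Ω] {P : Measure Ω}

/-- The filter on `ℕ × Ω` of the events that hold with (outer) probability tending to one.  A random
sequence converges in probability exactly when it converges along this filter, whether or not it is
measurable. -/
def inProb (P : Measure Ω) : Filter (ℕ × Ω) where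
  sets := {A | Tendsto (fun n => P {ω | (n, ω) ∉ A}) atTop (𝓝 0)}
  univ_sets := by simp
  sets_of_superset := by
    intro A B hA hAB
    refine tendsto_of_tendsto_of_tendsto_of_le_of_le tendsto_const_nhds hA (fun _ => zero_le)
      (fun n => measure_mono fun ω hω h => hω (hAB h))
  inter_sets := by
    intro A B hA hB
    have h := Tendsto.add hA hB
    rw [add_zero] at h
    refine tendsto_of_tendsto_of_tendsto_of_le_of_le tendsto_const_nhds h (fun _ => zero_le)
      (fun n => ?_)
    refine (measure_mono fun ω hω => ?_).trans (measure_union_le _ _)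
    by_contra hc
    simp only [Set.mem_union, Set.mem_ofPred_eq, not_or, not_not] at hc
    exact hω hc

lemma eventually_inProb {Q : ℕ × Ω → Prop} :
    (∀ᶠ z in inProb P, Q z) ↔ Tendsto (fun n => P {ω | ¬ Q (n, ω)}) atTop (𝓝 0) :=
  Iff.rfl

lemma tendsto_fst_inProb : Tendsto Prod.fst (inProb P) atTop := by
  intro A hA
  refine eventually_inProb.2 (tendsto_const_nhds.congr' ?_)
  filter_upwards [hA] with n hn
  simp [show n ∈ A from hn]

instance [IsProbabilityMeasure P] : (inProb P).NeBot := by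
  refine ⟨fun h => ?_⟩
  have : ∀ᶠ _ in inProb P, False := by rw [h]; exact eventually_bot
  have h2 := eventually_inProb.1 this
  simp only [not_false_eq_true, Set.ofPred_true, measure_univ] at h2
  exact one_ne_zero (tendsto_nhds_unique tendsto_const_nhds h2)

lemma toInProb_iff_tendsto {F : Type*} [PseudoEMetricSpace F] {X : ℕ → Ω → F} {c : F} :
    ToInProb P X c ↔ Tendsto (fun z : ℕ × Ω => X z.1 z.2) (inProb P) (𝓝 c) := by
  rw [EMetric.tendsto_nhds]
  simp only [ToInProb, TendstoInMeasure, eventually_inProb, not_lt]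

lemma ToInProb.tendsto {F : Type*} [PseudoEMetricSpace F] {X : ℕ → Ω → F} {c : F}
    (h : ToInProb P X c) : Tendsto (fun z : ℕ × Ω => X z.1 z.2) (inProb P) (𝓝 c) :=
  toInProb_iff_tendsto.1 h

lemma toInProb_of_tendsto {F : Type*} [PseudoEMetricSpace F] {X : ℕ × Ω → F} {c : F}
    (h : Tendsto X (inProb P) (𝓝 c)) : ToInProb P (fun n ω => X (n, ω)) c :=
  toInProb_iff_tendsto.2 h

lemma uniformlyInProb_iff {α F : Type*} [PseudoMetricSpace F] {A : Set α}
    {X : ℕ → Ω → α → F} {X₀ : α → F} : UniformlyInProb P A X X₀ ↔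
      ∀ ε : ℝ, 0 < ε → ∀ᶠ z in inProb P, ∀ a ∈ A, dist (X z.1 z.2 a) (X₀ a) < ε := by
  simp only [UniformlyInProb, eventually_inProb]
  refine forall₂_congr fun ε _ => ?_
  congr! 5
  push Not
  rfl

lemma UniformlyInProb.tendsto_sub {α F : Type*} [SeminormedAddCommGroup F] {A : Set α}
    {X : ℕ → Ω → α → F} {X₀ : α → F} (h : UniformlyInProb P A X X₀) {t : ℕ × Ω → α}
    (ht : ∀ᶠ z in inProb P, t z ∈ A) :
    Tendsto (fun z : ℕ × Ω => X z.1 z.2 (t z) - X₀ (t z)) (inProb P) (𝓝 0) := by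
  rw [Metric.tendsto_nhds]
  intro ε hε
  filter_upwards [uniformlyInProb_iff.1 h ε hε, ht] with z hz hzA
  simpa [dist_eq_norm] using hz _ hzA

/-- Stochastic boundedness along a filter: the product with every null sequence is a null sequence.
Along `inProb P` this is implied by `O_p(1)`. -/
def IsOp {ι F : Type*} [Norm F] (l : Filter ι) (X : ι → F) : Prop :=
  ∀ δ : ι → ℝ, Tendsto δ l (𝓝 0) → Tendsto (fun z => δ z * ‖X z‖) l (𝓝 0)

section IsOp

variable {ι F G : Type*} [SeminormedAddCommGroup F] [SeminormedAddCommGroup G] {l : Filter ι}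
  {X Y : ι → F}

lemma IsOp.of_le {Z : ι → G} (hX : IsOp l X) (C : ℝ) (h : ∀ᶠ z in l, ‖Z z‖ ≤ C * ‖X z‖) :
    IsOp l Z := by
  intro δ hδ
  have h1 : Tendsto (fun z => |C * (δ z * ‖X z‖)|) l (𝓝 0) := by
    simpa using ((hX δ hδ).const_mul C).abs
  refine squeeze_zero_norm' ?_ h1
  filter_upwards [h] with z hz
  rw [norm_mul, norm_norm, Real.norm_eq_abs]
  calc |δ z| * ‖Z z‖ ≤ |δ z| * (C * ‖X z‖) := by gcongr
    _ = C * (|δ z| * ‖X z‖) := by ring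
    _ ≤ |C| * (|δ z| * ‖X z‖) := by gcongr; exact le_abs_self C
    _ = |C * (δ z * ‖X z‖)| := by rw [abs_mul, abs_mul, abs_norm]

lemma IsOp.add (hX : IsOp l X) (hY : IsOp l Y) : IsOp l (fun z => X z + Y z) := by
  intro δ hδ
  have h1 : Tendsto (fun z => |δ z * ‖X z‖| + |δ z * ‖Y z‖|) l (𝓝 0) := by
    simpa using (hX δ hδ).abs.add (hY δ hδ).abs
  refine squeeze_zero_norm (fun z => ?_) h1
  rw [norm_mul, norm_norm, Real.norm_eq_abs, abs_mul, abs_mul, abs_norm, abs_norm, ← mul_add]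
  gcongr
  exact norm_add_le _ _

lemma IsOp.neg (hX : IsOp l X) : IsOp l (fun z => - X z) :=
  hX.of_le 1 (by simp)

lemma IsOp.sub (hX : IsOp l X) (hY : IsOp l Y) : IsOp l (fun z => X z - Y z) := by
  simpa only [sub_eq_add_neg] using hX.add hY.neg

lemma isOp_of_tendsto {c : F} (hX : Tendsto X l (𝓝 c)) : IsOp l X := by
  intro δ hδ
  simpa using hδ.mul hX.norm

lemma IsOp.congr' (hX : IsOp l X) (h : X =ᶠ[l] Y) : IsOp l Y :=
  hX.of_le 1 (by filter_upwards [h] with z hz; simp [hz])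

/-- A remainder bounded by a null factor times a stochastically bounded sequence is null. -/
lemma IsOp.tendsto_zero_of_le {Z : ι → G} (hX : IsOp l X) {δ : ι → ℝ} (hδ : Tendsto δ l (𝓝 0))
    (h : ∀ᶠ z in l, ‖Z z‖ ≤ δ z * ‖X z‖) : Tendsto Z l (𝓝 0) :=
  squeeze_zero_norm' h (hX δ hδ)

end IsOp

lemma BoundedInProb.isOp {F : Type*} [SeminormedAddCommGroup F] {X : ℕ → Ω → F}
    (h : BoundedInProb P X) : IsOp (inProb P) (fun z : ℕ × Ω => X z.1 z.2) := by
  intro δ hδ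
  rw [Metric.tendsto_nhds]
  intro ε hε
  rw [eventually_inProb, ENNReal.tendsto_nhds_zero]
  intro η hη
  obtain ⟨C, hC⟩ := h (η / 2) (ENNReal.half_pos hη.ne')
  have hC' : 0 < |C| + 1 := by positivity
  have hδ' := Metric.tendsto_nhds.1 hδ (ε / (|C| + 1)) (by positivity)
  rw [eventually_inProb, ENNReal.tendsto_nhds_zero] at hδ'
  filter_upwards [hC, hδ' (η / 2) (ENNReal.half_pos hη.ne')] with n h1 h2
  rw [← ENNReal.add_halves η]
  refine le_trans (le_trans (measure_mono ?_) (measure_union_le _ _)) (add_le_add h1 h2)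
  intro ω hω
  by_contra hc
  simp only [Set.mem_union, Set.mem_ofPred_eq, not_or, not_lt, dist_zero_right,
    Real.norm_eq_abs] at hc hω
  refine absurd hω (not_le.2 ?_)
  rw [abs_mul, abs_norm]
  calc |δ (n, ω)| * ‖X n ω‖ ≤ |δ (n, ω)| * (|C| + 1) := by
        gcongr; exact hc.1.trans ((le_abs_self C).trans (by linarith))
    _ < ε / (|C| + 1) * (|C| + 1) := by gcongr; exact not_le.1 hc.2
    _ = ε := by field_simp

end InProb

section InDistribution

variable {Ω Ω' F : Type*} [MeasurableSpace Ω] {P : Measure Ω} [IsProbabilityMeasure P]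
  [MeasurableSpace Ω'] {P' : Measure Ω'} [IsProbabilityMeasure P']
  [NormedAddCommGroup F] [MeasurableSpace F] [BorelSpace F]

/-- Sequences that converge in distribution are stochastically bounded, by the portmanteau theorem
applied to the complements of large balls. -/
lemma isOp_of_tendstoInDistribution {X : ℕ → Ω → F} {Z : Ω' → F}
    (h : TendstoInDistribution X atTop Z (fun _ => P) P') :
    IsOp (inProb P) (fun z : ℕ × Ω => X z.1 z.2) := by
  refine BoundedInProb.isOp fun ε hε => ?_
  have hZ := h.aemeasurable_limit
  have hprob : IsProbabilityMeasure (P'.map Z) := Measure.isProbabilityMeasure_map hZ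
  have hlim : Tendsto (fun k : ℕ => (P'.map Z) {x | (k : ℝ) ≤ ‖x‖}) atTop (𝓝 0) := by
    have := tendsto_measure_iInter_atTop (μ := P'.map Z) (s := fun k : ℕ => {x : F | (k : ℝ) ≤ ‖x‖})
      (fun k => (isClosed_le continuous_const continuous_norm).measurableSet.nullMeasurableSet)
      (fun i j hij x hx => le_trans (by exact_mod_cast hij) (Set.mem_ofPred_eq ▸ hx))
      ⟨0, measure_ne_top _ _⟩
    have hempty : (⋂ k : ℕ, {x : F | (k : ℝ) ≤ ‖x‖}) = ∅ := by
      ext x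
      simp only [Set.mem_iInter, Set.mem_ofPred_eq, Set.mem_empty_iff_false, iff_false, not_forall,
        not_le]
      exact exists_nat_gt _
    rwa [hempty, measure_empty] at this
  obtain ⟨k, hk⟩ := (hlim.eventually_lt_const hε).exists
  have hclosed : IsClosed {x : F | (k : ℝ) ≤ ‖x‖} := isClosed_le continuous_const continuous_norm
  have hport := ProbabilityMeasure.limsup_measure_closed_le_of_tendsto h.tendsto hclosed
  refine ⟨k, ?_⟩
  have hev := eventually_lt_of_limsup_lt (lt_of_le_of_lt hport hk)
  filter_upwards [hev] with n hn
  refine le_trans ?_ hn.le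
  change _ ≤ (P.map (X n)) {x | (k : ℝ) ≤ ‖x‖}
  rw [Measure.map_apply_of_aemeasurable (h.forall_aemeasurable n) hclosed.measurableSet]
  exact measure_mono fun ω hω => le_of_lt (Set.mem_ofPred_eq ▸ hω)

lemma tendstoInDistribution_of_tendsto_sub [SecondCountableTopology F] {X Y : ℕ → Ω → F}
    {Z : Ω' → F}
    (h : TendstoInDistribution X atTop Z (fun _ => P) P')
    (hXY : Tendsto (fun z : ℕ × Ω => Y z.1 z.2 - X z.1 z.2) (inProb P) (𝓝 0))
    (hY : ∀ n, AEMeasurable (Y n) P) : TendstoInDistribution Y atTop Z (fun _ => P) P' :=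
  tendstoInDistribution_of_tendstoInMeasure_sub Y Z h
    (toInProb_iff_tendsto (X := fun n ω => Y n ω - X n ω).2 hXY) hY

end InDistribution

/-! ### Matrices acting on Euclidean space -/

section Act

variable {p q k : ℕ}

lemma act_apply (A : Matrix (Fin q) (Fin p) ℝ) (v : E p) (i : Fin q) :
    act A v i = ∑ j, A i j * v j := rfl

lemma act_mul (A : Matrix (Fin k) (Fin q) ℝ) (B : Matrix (Fin q) (Fin p) ℝ) (v : E p) :
    act (A * B) v = act A (act B v) := by
  simp [act, Matrix.mulVec_mulVec]

lemma act_one (v : E p) : act (1 : Matrix (Fin p) (Fin p) ℝ) v = v := by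
  simp [act]

/-- The linear map `A ↦ (v ↦ A v)` from matrices to continuous linear maps. -/
def matCLM : Matrix (Fin q) (Fin p) ℝ →ₗ[ℝ] (E p →L[ℝ] E q) where
  toFun A := LinearMap.toContinuousLinearMap
    { toFun := act A
      map_add' := fun v w => by ext i; simp [act, Matrix.mulVec_add]
      map_smul' := fun c v => by ext i; simp [act, Matrix.mulVec_smul] }
  map_add' A B := by ext v i; simp [act, Matrix.add_mulVec]
  map_smul' c A := by ext v i; simp [act, Matrix.smul_mulVec]

@[simp] lemma matCLM_apply (A : Matrix (Fin q) (Fin p) ℝ) (v : E p) : matCLM A v = act A v := rfl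

lemma continuous_matCLM : Continuous (matCLM : Matrix (Fin q) (Fin p) ℝ →ₗ[ℝ] (E p →L[ℝ] E q)) :=
  LinearMap.continuous_of_finiteDimensional _

lemma continuous_act (A : Matrix (Fin q) (Fin p) ℝ) : Continuous (act A) :=
  (matCLM A).continuous

lemma act_sub (A : Matrix (Fin q) (Fin p) ℝ) (v w : E p) : act A (v - w) = act A v - act A w :=
  (matCLM A).map_sub v w

lemma act_smul (A : Matrix (Fin q) (Fin p) ℝ) (c : ℝ) (v : E p) : act A (c • v) = c • act A v :=
  (matCLM A).map_smul c v

@[simp] lemma act_zero (A : Matrix (Fin q) (Fin p) ℝ) : act A 0 = 0 :=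
  (matCLM A).map_zero

lemma sub_act (A B : Matrix (Fin q) (Fin p) ℝ) (v : E p) :
    act (A - B) v = act A v - act B v := by
  rw [← matCLM_apply, map_sub]; rfl

lemma smul_act (c : ℝ) (A : Matrix (Fin q) (Fin p) ℝ) (v : E p) :
    act (c • A) v = c • act A v := by
  rw [← matCLM_apply, map_smul]; rfl

lemma norm_act_le (A : Matrix (Fin q) (Fin p) ℝ) (v : E p) : ‖act A v‖ ≤ ‖matCLM A‖ * ‖v‖ :=
  (matCLM A).le_opNorm v

lemma inner_act (A : Matrix (Fin q) (Fin p) ℝ) (x : E q) (y : E p) :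
    inner ℝ x (act A y) = inner ℝ (act Aᵀ x) y := by
  simp only [EuclideanSpace.inner_eq_star_dotProduct, act, star_trivial]
  rw [Matrix.mulVec_transpose, dotProduct_comm, Matrix.dotProduct_mulVec, dotProduct_comm]

lemma wnorm_eq_inner (W : Matrix (Fin p) (Fin p) ℝ) (a : E p) :
    wnorm W a = inner ℝ a (act W a) := by
  simp only [EuclideanSpace.inner_eq_star_dotProduct, act, star_trivial, wnorm]
  rw [dotProduct_comm]

lemma abs_wnorm_le (W : Matrix (Fin p) (Fin p) ℝ) (a : E p) :
    |wnorm W a| ≤ ‖matCLM W‖ * ‖a‖ ^ 2 := by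
  rw [wnorm_eq_inner]
  calc _ ≤ ‖a‖ * ‖act W a‖ := abs_real_inner_le_norm _ _
    _ ≤ ‖a‖ * (‖matCLM W‖ * ‖a‖) := by gcongr; exact norm_act_le _ _
    _ = _ := by ring

lemma wnorm_sub_left (V W : Matrix (Fin p) (Fin p) ℝ) (a : E p) :
    wnorm (V - W) a = wnorm V a - wnorm W a := by
  simp [wnorm_eq_inner, sub_act, inner_sub_right]

lemma wnorm_smul_left (c : ℝ) (W : Matrix (Fin p) (Fin p) ℝ) (a : E p) :
    wnorm (c • W) a = c * wnorm W a := by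
  simp [wnorm_eq_inner, smul_act, inner_smul_right]

lemma wnorm_nonneg {W : Matrix (Fin p) (Fin p) ℝ} (hW : W.PosSemidef) (a : E p) :
    0 ≤ wnorm W a := by
  simpa [wnorm] using hW.dotProduct_mulVec_nonneg a.ofLp

lemma posSemidef_of_wnorm_nonneg {W : Matrix (Fin p) (Fin p) ℝ} (hW : Wᵀ = W)
    (h : ∀ a : E p, 0 ≤ wnorm W a) : W.PosSemidef :=
  Matrix.PosSemidef.of_dotProduct_mulVec_nonneg (by simpa [Matrix.IsHermitian] using hW)
    fun x => by simpa [wnorm] using h (WithLp.toLp 2 x)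

/-- If the quadratic form of a positive semidefinite invertible matrix `A` is at most `K ‖x‖²`, then
that of `A⁻¹` is at least `K⁻¹ ‖x‖²`. -/
lemma sq_norm_le_mul_wnorm_inv {A : Matrix (Fin p) (Fin p) ℝ} (hA : A.PosSemidef)
    (hu : IsUnit A.det) {K : ℝ} (hK : ∀ x : E p, wnorm A x ≤ K * ‖x‖ ^ 2) (x : E p) :
    ‖x‖ ^ 2 ≤ K * wnorm A⁻¹ x := by
  have hsym : Aᵀ = A := by simpa [Matrix.IsHermitian] using hA.isHermitian
  set y := act A⁻¹ x with hy
  have hx : act A y = x := by rw [hy, ← act_mul, Matrix.mul_nonsing_inv _ hu, act_one]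
  have hw : wnorm A⁻¹ x = inner ℝ x y := wnorm_eq_inner _ _
  have hyy : wnorm A y = inner ℝ x y := by rw [wnorm_eq_inner, hx, real_inner_comm]
  -- The form of `A` is nonnegative at `t y - x`, where `x = A y`.
  have h1 : ∀ t : ℝ, 0 ≤ t ^ 2 * inner ℝ x y - 2 * t * ‖x‖ ^ 2 + wnorm A x := by
    intro t
    have h2 := wnorm_nonneg hA (t • y - x)
    have h3 : inner ℝ y (act A x) = ‖x‖ ^ 2 := by
      rw [inner_act, hsym, hx, real_inner_self_eq_norm_sq]
    rw [wnorm_eq_inner, act_sub, act_smul, hx, inner_sub_left, inner_sub_right, inner_sub_right,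
      real_inner_smul_left, real_inner_smul_left, real_inner_smul_right, real_inner_smul_right, h3,
      real_inner_self_eq_norm_sq, real_inner_comm, ← wnorm_eq_inner A x] at h2
    linarith
  have h4 := hK x
  rw [hw]
  rcases le_or_gt K 0 with hK0 | hK0
  · have h5 := hK y
    have h6 := h1 1
    rw [hyy] at h5
    have h7 : inner ℝ x y ≤ 0 := h5.trans (mul_nonpos_of_nonpos_of_nonneg hK0 (sq_nonneg _))
    nlinarith [mul_nonpos_of_nonpos_of_nonneg hK0 (sq_nonneg ‖x‖),
      mul_nonneg_of_nonpos_of_nonpos hK0 h7]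
  · have h10 : K * ‖x‖ ^ 2 ≤ K * (K * inner ℝ x y) := by nlinarith [h1 K]
    exact le_of_mul_le_mul_left h10 hK0

/-- Positive definite limits of weight matrices: the weighted norms are eventually comparable to
the Euclidean norm. -/
lemma eventually_wnorm_bounds {ι : Type*} {l : Filter ι} {A : ι → Matrix (Fin p) (Fin p) ℝ}
    {W : Matrix (Fin p) (Fin p) ℝ} (hA : Tendsto A l (𝓝 W)) (hW : W.PosDef) :
    ∃ c C : ℝ, 0 < c ∧ 0 < C ∧ ∀ᶠ z in l, ∀ x : E p,
      ‖x‖ ^ 2 ≤ c * wnorm (A z) x ∧ wnorm (A z) x ≤ C * ‖x‖ ^ 2 := by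
  have hu : IsUnit W.det := (Matrix.isUnit_iff_isUnit_det _).1 hW.isUnit
  have hui : IsUnit (W⁻¹).det := (Matrix.isUnit_iff_isUnit_det _).1 hW.inv.isUnit
  set K : ℝ := ‖matCLM W⁻¹‖ + 1 with hKdef
  have hK : 0 < K := by positivity
  have hlow : ∀ x : E p, ‖x‖ ^ 2 ≤ K * wnorm W x := by
    intro x
    have := sq_norm_le_mul_wnorm_inv (A := W⁻¹) hW.inv.posSemidef hui (K := K)
      (fun x => ((le_abs_self _).trans (abs_wnorm_le _ _)).trans
        (mul_le_mul_of_nonneg_right (by linarith) (by positivity))) x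
    rwa [Matrix.nonsing_inv_nonsing_inv _ hu] at this
  refine ⟨2 * K, ‖matCLM W‖ + K⁻¹ / 2, by positivity, by positivity, ?_⟩
  have hcont := (continuous_matCLM (p := p) (q := p)).tendsto W |>.comp hA
  rw [Metric.tendsto_nhds] at hcont
  filter_upwards [hcont (K⁻¹ / 2) (by positivity)] with z hz x
  rw [dist_eq_norm, Function.comp_apply, ← map_sub] at hz
  have h1 := abs_wnorm_le (A z - W) x
  rw [wnorm_sub_left] at h1
  have h2 : |wnorm (A z) x - wnorm W x| ≤ K⁻¹ / 2 * ‖x‖ ^ 2 :=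
    h1.trans (by gcongr)
  rw [abs_le] at h2
  have h3 := (le_abs_self _).trans (abs_wnorm_le W x)
  have h4 := hlow x
  constructor
  · have h5 : K * (K⁻¹ / 2 * ‖x‖ ^ 2) = ‖x‖ ^ 2 / 2 := by field_simp
    nlinarith
  · nlinarith

lemma tendsto_matrix_mul {ι : Type*} {l : Filter ι} {A : ι → Matrix (Fin k) (Fin q) ℝ}
    {B : ι → Matrix (Fin q) (Fin p) ℝ} {A₀ : Matrix (Fin k) (Fin q) ℝ}
    {B₀ : Matrix (Fin q) (Fin p) ℝ} (hA : Tendsto A l (𝓝 A₀)) (hB : Tendsto B l (𝓝 B₀)) :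
    Tendsto (fun z => A z * B z) l (𝓝 (A₀ * B₀)) := by
  have h : Continuous fun x : Matrix (Fin k) (Fin q) ℝ × Matrix (Fin q) (Fin p) ℝ => x.1 * x.2 :=
    continuous_fst.matrix_mul continuous_snd
  exact (h.tendsto (A₀, B₀)).comp (hA.prodMk_nhds hB)

lemma tendsto_matrix_inv {ι : Type*} {l : Filter ι} {A : ι → Matrix (Fin p) (Fin p) ℝ}
    {A₀ : Matrix (Fin p) (Fin p) ℝ} (hA : Tendsto A l (𝓝 A₀)) (h : IsUnit A₀.det) :
    Tendsto (fun z => (A z)⁻¹) l (𝓝 A₀⁻¹) := by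
  have hdet : Tendsto (fun z => (A z).det) l (𝓝 A₀.det) :=
    ((continuous_id.matrix_det).tendsto A₀).comp hA
  have hadj : Tendsto (fun z => (A z).adjugate) l (𝓝 A₀.adjugate) :=
    ((continuous_id.matrix_adjugate).tendsto A₀).comp hA
  simp only [Matrix.inv_def, Ring.inverse_eq_inv']
  exact (hdet.inv₀ h.ne_zero).smul hadj

lemma tendsto_act {ι : Type*} {l : Filter ι} {A : ι → Matrix (Fin q) (Fin p) ℝ}
    {A₀ : Matrix (Fin q) (Fin p) ℝ} {x : ι → E p} {x₀ : E p} (hA : Tendsto A l (𝓝 A₀))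
    (hx : Tendsto x l (𝓝 x₀)) : Tendsto (fun z => act (A z) (x z)) l (𝓝 (act A₀ x₀)) :=
  ((isBoundedBilinearMap_apply (𝕜 := ℝ)).continuous.tendsto (matCLM A₀, x₀)).comp
    (((continuous_matCLM.tendsto A₀).comp hA).prodMk_nhds hx)

lemma IsOp.tendsto_act_sub {ι : Type*} {l : Filter ι} {A : ι → Matrix (Fin q) (Fin p) ℝ}
    {A₀ : Matrix (Fin q) (Fin p) ℝ} {x : ι → E p} (hA : Tendsto A l (𝓝 A₀)) (hx : IsOp l x) :
    Tendsto (fun z => act (A z) (x z) - act A₀ (x z)) l (𝓝 0) := by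
  have h : Tendsto (fun z => ‖matCLM (A z - A₀)‖) l (𝓝 0) := by
    have := (continuous_matCLM.tendsto _).comp (tendsto_sub_nhds_zero_iff.2 hA)
    simpa using this.norm
  refine hx.tendsto_zero_of_le h (Eventually.of_forall fun z => ?_)
  rw [← sub_act]
  exact norm_act_le _ _

lemma IsOp.act {ι : Type*} {l : Filter ι} {A : ι → Matrix (Fin q) (Fin p) ℝ}
    {A₀ : Matrix (Fin q) (Fin p) ℝ} {x : ι → E p} (hx : IsOp l x) (hA : Tendsto A l (𝓝 A₀)) :
    IsOp l (fun z => act (A z) (x z)) := by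
  have h1 : IsOp l (fun z => IndirectInference.act A₀ (x z)) :=
    hx.of_le ‖matCLM A₀‖ (Eventually.of_forall fun z => norm_act_le _ _)
  refine ((isOp_of_tendsto (hx.tendsto_act_sub hA)).add h1).congr'
    (Eventually.of_forall fun z => ?_)
  simp

end Act

/-! ### Jacobian matrices and the mean value inequality -/

section Jacobian

variable {p q : ℕ}

lemma matCLM_jacobian (f : E q → E p) (x : E q) : matCLM (jacobian f x) = fderiv ℝ f x := by
  refine ContinuousLinearMap.coe_injective
    ((EuclideanSpace.basisFun (Fin q) ℝ).toBasis.ext fun j => ?_)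
  ext i
  simp [act_apply, jacobian]

lemma act_jacobian (f : E q → E p) (x v : E q) : act (jacobian f x) v = fderiv ℝ f x v := by
  rw [← matCLM_jacobian, matCLM_apply]

lemma tendsto_jacobian_of_fderiv {ι : Type*} {l : Filter ι} {f : ι → E q → E p} {x : ι → E q}
    {g : E q → E p} {y : E q}
    (h : Tendsto (fun z => fderiv ℝ (f z) (x z)) l (𝓝 (fderiv ℝ g y))) :
    Tendsto (fun z => jacobian (f z) (x z)) l (𝓝 (jacobian g y)) := by
  refine tendsto_pi_nhds.2 fun i => tendsto_pi_nhds.2 fun j => ?_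
  have h1 := (((ContinuousLinearMap.apply ℝ (E p)
    (EuclideanSpace.single j (1 : ℝ))).continuous).tendsto _).comp h
  exact ((EuclideanSpace.proj (𝕜 := ℝ) i).continuous.tendsto _).comp h1

lemma tendsto_fderiv_of_jacobian {ι : Type*} {l : Filter ι} {f : ι → E q → E p} {x : ι → E q}
    {g : E q → E p} {y : E q}
    (h : ∀ i j, Tendsto (fun z => jacobian (f z) (x z) i j) l (𝓝 (jacobian g y i j))) :
    Tendsto (fun z => fderiv ℝ (f z) (x z)) l (𝓝 (fderiv ℝ g y)) := by
  simp only [← matCLM_jacobian]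
  exact (continuous_matCLM.tendsto _).comp
    (tendsto_pi_nhds.2 fun i => tendsto_pi_nhds.2 fun j => h i j)

/-- The mean value inequality with an explicit intermediate point: the linearization error of `f`
with slope `A` is attained by the error of the derivative at some point of the segment. -/
lemma exists_segment_norm_sub_le {F G : Type*} [NormedAddCommGroup F] [NormedSpace ℝ F]
    [NormedAddCommGroup G] [InnerProductSpace ℝ G] {f : F → G} {x y : F} (A : F →L[ℝ] G)
    (hf : ∀ z ∈ segment ℝ x y, DifferentiableAt ℝ f z) :
    ∃ ξ ∈ segment ℝ x y, ‖f y - f x - A (y - x)‖ ≤ ‖fderiv ℝ f ξ - A‖ * ‖y - x‖ := by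
  set v := f y - f x - A (y - x) with hv
  have hmem : ∀ t ∈ Set.Icc (0 : ℝ) 1, x + t • (y - x) ∈ segment ℝ x y := by
    intro t ht
    rw [segment_eq_image']
    exact ⟨t, ht, rfl⟩
  -- The mean value theorem is applied to the error along the segment, projected on `v`.
  let φ : ℝ → ℝ := fun t => inner ℝ v (f (x + t • (y - x)) - t • A (y - x))
  have hder : ∀ t ∈ Set.Icc (0 : ℝ) 1, HasDerivAt φ
      (inner ℝ v ((fderiv ℝ f (x + t • (y - x)) - A) (y - x))) t := by
    intro t ht
    have h1 : HasDerivAt (fun t : ℝ => x + t • (y - x)) (y - x) t := by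
      simpa using ((hasDerivAt_id t).smul_const (y - x)).const_add x
    have h2 := (hf _ (hmem t ht)).hasFDerivAt.comp_hasDerivAt t h1
    have h3 : HasDerivAt (fun t : ℝ => t • A (y - x)) (A (y - x)) t := by
      simpa using (hasDerivAt_id t).smul_const (A (y - x))
    have h4 := (innerSL ℝ v).hasFDerivAt.comp_hasDerivAt t (h2.sub h3)
    simpa [φ, Function.comp_def] using! h4
  obtain ⟨t, ht, hφ⟩ := exists_hasDerivAt_eq_slope φ
    (fun t => inner ℝ v ((fderiv ℝ f (x + t • (y - x)) - A) (y - x))) zero_lt_one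
    (fun t ht => (hder t ht).continuousAt.continuousWithinAt)
    (fun t ht => hder t (Set.Ioo_subset_Icc_self ht))
  refine ⟨_, hmem t (Set.Ioo_subset_Icc_self ht), ?_⟩
  have h5 : φ 1 - φ 0 = ‖v‖ ^ 2 := by
    simp only [φ, one_smul, add_sub_cancel, zero_smul, add_zero, sub_zero]
    rw [← inner_sub_right, ← real_inner_self_eq_norm_sq]
    congr 1
    rw [hv]; abel
  rw [h5, sub_zero, div_one] at hφ
  rcases eq_or_ne ‖v‖ 0 with h0 | h0
  · rw [h0]; positivity
  have h6 : ‖v‖ * ‖v‖ ≤ ‖v‖ * (‖fderiv ℝ f (x + t • (y - x)) - A‖ * ‖y - x‖) := by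
    rw [← sq, ← hφ]
    exact (real_inner_le_norm _ _).trans
      (by gcongr; exact ContinuousLinearMap.le_opNorm _ _)
  exact le_of_mul_le_mul_left h6 (lt_of_le_of_ne (norm_nonneg _) h0.symm)

/-- Linearization along random arguments: if `f z` has derivatives converging to `A` along every
sequence that converges to `x₀`, then `f z (y z) = f z x₀ + A (y z - x₀) + o(‖y z - x₀‖)`. -/
lemma exists_linearization {ι F G : Type*} [NormedAddCommGroup F] [NormedSpace ℝ F]
    [NormedAddCommGroup G] [InnerProductSpace ℝ G] {l : Filter ι} {f : ι → F → G} {U : Set F}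
    {x₀ : F} (hU : U ∈ 𝓝 x₀) (hf : ∀ z, ∀ x ∈ U, DifferentiableAt ℝ (f z) x) {A : F →L[ℝ] G}
    (hA : ∀ ξ : ι → F, Tendsto ξ l (𝓝 x₀) → Tendsto (fun z => fderiv ℝ (f z) (ξ z)) l (𝓝 A))
    {y : ι → F} (hy : Tendsto y l (𝓝 x₀)) :
    ∃ δ : ι → ℝ, Tendsto δ l (𝓝 0) ∧
      ∀ᶠ z in l, ‖f z (y z) - f z x₀ - A (y z - x₀)‖ ≤ δ z * ‖y z - x₀‖ := by
  classical
  obtain ⟨r, hr, hball⟩ := Metric.mem_nhds_iff.1 hU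
  have hseg : ∀ z, y z ∈ Metric.ball x₀ r → ∀ w ∈ segment ℝ x₀ (y z),
      DifferentiableAt ℝ (f z) w := fun z hz w hw =>
    hf z w (hball ((convex_ball x₀ r).segment_subset (Metric.mem_ball_self hr) hz hw))
  have hex : ∀ z, ∃ ξ ∈ segment ℝ x₀ (y z), y z ∈ Metric.ball x₀ r →
      ‖f z (y z) - f z x₀ - A (y z - x₀)‖ ≤ ‖fderiv ℝ (f z) ξ - A‖ * ‖y z - x₀‖ := by
    intro z
    by_cases hz : y z ∈ Metric.ball x₀ r
    · obtain ⟨ξ, h1, h2⟩ := exists_segment_norm_sub_le A (hseg z hz)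
      exact ⟨ξ, h1, fun _ => h2⟩
    · exact ⟨x₀, left_mem_segment ℝ _ _, fun h => absurd h hz⟩
  choose ξ hξ1 hξ2 using hex
  have hξ : Tendsto ξ l (𝓝 x₀) := by
    rw [tendsto_iff_norm_sub_tendsto_zero] at hy ⊢
    refine squeeze_zero (fun _ => norm_nonneg _) (fun z => ?_) hy
    have h1 := hξ1 z
    rw [segment_eq_image'] at h1
    obtain ⟨t, ht, h2⟩ := h1
    rw [← h2, add_sub_cancel_left, norm_smul, Real.norm_eq_abs, abs_of_nonneg ht.1]
    exact mul_le_of_le_one_left (norm_nonneg _) ht.2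
  refine ⟨fun z => ‖fderiv ℝ (f z) (ξ z) - A‖,
    tendsto_iff_norm_sub_tendsto_zero.1 (hA ξ hξ), ?_⟩
  filter_upwards [hy (Metric.ball_mem_nhds x₀ hr)] with z hz using hξ2 z hz

end Jacobian

/-! ### Sums of independent random sequences -/

section Concentration

variable {Ω : Type*} [MeasurableSpace Ω] {P : Measure Ω} [IsProbabilityMeasure P]

lemma exists_notMem_of_measure_lt_one {A : Set Ω} (h : P A < 1) : ∃ ω, ω ∉ A := by
  by_contra! hc
  have : A = Set.univ := Set.eq_univ_of_forall hc
  simp [this] at h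

/-- Conditioning on the second of two independent random sequences: it may be replaced by a
deterministic sequence without increasing the probability that the sum fails to converge to `c`. -/
lemma exists_measure_not_tendsto_add_le {U V : Ω → ℕ → ℝ} (hU : Measurable U) (hV : Measurable V)
    (h : IndepFun U V P) (c : ℝ) : ∃ v : ℕ → ℝ,
      P {ω | ¬ Tendsto (U ω + v) atTop (𝓝 c)} ≤ P {ω | ¬ Tendsto (U ω + V ω) atTop (𝓝 c)} := by
  have hprobU : IsProbabilityMeasure (P.map U) := Measure.isProbabilityMeasure_map hU.aemeasurable
  have hprobV : IsProbabilityMeasure (P.map V) := Measure.isProbabilityMeasure_map hV.aemeasurable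
  set A : Set ((ℕ → ℝ) × (ℕ → ℝ)) := {x | ¬ Tendsto (x.1 + x.2) atTop (𝓝 c)} with hA
  have hAm : MeasurableSet A := by
    refine MeasurableSet.compl (measurableSet_tendsto (𝓝 c) fun n => ?_)
    exact ((measurable_pi_apply n).comp measurable_fst).add
      ((measurable_pi_apply n).comp measurable_snd)
  have h1 := (indepFun_iff_map_prod_eq_prod_map_map hU.aemeasurable hV.aemeasurable).1 h
  have h2 : P {ω | ¬ Tendsto (U ω + V ω) atTop (𝓝 c)} = ((P.map U).prod (P.map V)) A := by
    rw [← h1, Measure.map_apply (hU.prodMk hV) hAm]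
    rfl
  rw [h2, Measure.prod_apply_symm hAm]
  obtain ⟨v, hv⟩ := exists_le_lintegral (μ := P.map V)
    (f := fun v => (P.map U) ((fun u => (u, v)) ⁻¹' A))
    (measurable_measure_prodMk_right hAm).aemeasurable
  refine ⟨v, le_trans (le_of_eq ?_) hv⟩
  exact (Measure.map_apply hU ((measurable_id.prodMk measurable_const) hAm)).symm

/-- Let finitely many independent random sequences each be null with probability at least `3/4`.  If
their sum has the deterministic limit `c` with probability at least `3/4`, then `c = 0`.  The number
of summands does not enter: when the sum concentrates so do all its partial sums, and the centres of
the partial sums vanish one after the other. -/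
lemma eq_zero_of_tendsto_sum {W : ℕ → Ω → ℕ → ℝ} (hm : ∀ r, Measurable (W r))
    (hind : iIndepFun W P) (h0 : ∀ r, P {ω | ¬ Tendsto (W r ω) atTop (𝓝 0)} ≤ 4⁻¹) {N : ℕ} {c : ℝ}
    (hc : P {ω | ¬ Tendsto (∑ r ∈ Finset.range N, W r ω) atTop (𝓝 c)} ≤ 4⁻¹) : c = 0 := by
  have h34 : (4⁻¹ + 4⁻¹ + 4⁻¹ : ENNReal) < 1 := by
    have h4 : (4⁻¹ : ENNReal) = ENNReal.ofReal 4⁻¹ := by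
      rw [ENNReal.ofReal_inv_of_pos (by norm_num)]; norm_num
    rw [h4, ← ENNReal.ofReal_add (by norm_num) (by norm_num),
      ← ENNReal.ofReal_add (by norm_num) (by norm_num)]
    exact ENNReal.ofReal_lt_one.2 (by norm_num)
  have hsum : ∀ T : Finset ℕ, Measurable fun ω => ∑ r ∈ T, W r ω := fun T =>
    Finset.measurable_fun_sum _ fun r _ => hm r
  have key : ∀ j ≤ N, P {ω | ¬ Tendsto (∑ r ∈ Finset.range j, W r ω) atTop (𝓝 0)} ≤ 4⁻¹ := by
    intro j
    induction j with
    | zero =>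
      intro _
      have : {ω | ¬ Tendsto (∑ r ∈ Finset.range 0, W r ω) atTop (𝓝 0)} = ∅ := by
        refine Set.eq_empty_of_forall_notMem fun ω h => h ?_
        rw [Finset.sum_range_zero]
        exact tendsto_const_nhds
      rw [this, measure_empty]
      exact bot_le
    | succ j ih =>
      intro hj
      have hdisj : Disjoint (Finset.range (j + 1)) (Finset.Ico (j + 1) N) := by
        rw [Finset.disjoint_left]; intro a; simp; omega
      have hindep : IndepFun (fun ω => ∑ r ∈ Finset.range (j + 1), W r ω)
          (fun ω => ∑ r ∈ Finset.Ico (j + 1) N, W r ω) P := by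
        have := (hind.indepFun_finset _ _ hdisj hm).comp
          (φ := fun x : (Finset.range (j + 1)) → ℕ → ℝ => ∑ i, x i)
          (ψ := fun x : (Finset.Ico (j + 1) N) → ℕ → ℝ => ∑ i, x i)
          (Finset.measurable_fun_sum _ fun i _ => measurable_pi_apply i)
          (Finset.measurable_fun_sum _ fun i _ => measurable_pi_apply i)
        convert this using 1 <;> funext ω <;> simp only [Function.comp_apply]
        · exact (Finset.sum_coe_sort (Finset.range (j + 1)) fun i => W i ω).symm
        · exact (Finset.sum_coe_sort (Finset.Ico (j + 1) N) fun i => W i ω).symm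
      obtain ⟨d, hd⟩ := exists_measure_not_tendsto_add_le (hsum _) (hsum _) hindep c
      simp only [Finset.sum_range_add_sum_Ico _ hj] at hd
      replace hd := hd.trans hc
      obtain ⟨ω, hω⟩ : ∃ ω, ω ∉ ({ω | ¬ Tendsto (∑ r ∈ Finset.range j, W r ω) atTop (𝓝 0)} ∪
          {ω | ¬ Tendsto (W j ω) atTop (𝓝 0)}) ∪
          {ω | ¬ Tendsto (∑ r ∈ Finset.range (j + 1), W r ω + d) atTop (𝓝 c)} := by
        refine exists_notMem_of_measure_lt_one (P := P) (lt_of_le_of_lt ?_ h34)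
        refine (measure_union_le _ _).trans (add_le_add ?_ hd)
        exact (measure_union_le _ _).trans (add_le_add (ih (by omega)) (h0 j))
      simp only [Set.mem_union, Set.mem_ofPred_eq, not_or, not_not] at hω
      -- A single outcome identifies the limit of the deterministic sequence `d`.
      have hdc : Tendsto d atTop (𝓝 c) := by
        have h1 := hω.2.sub (hω.1.1.add hω.1.2)
        rw [add_zero, sub_zero] at h1
        refine h1.congr fun k => ?_
        simp [Finset.sum_range_succ]
      refine (measure_mono ?_).trans hd
      intro ω hω hn
      refine hω ?_
      have h1 := hn.sub hdc
      rw [sub_self] at h1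
      exact h1.congr fun k => by simp
  obtain ⟨ω, hω⟩ : ∃ ω, ω ∉ {ω | ¬ Tendsto (∑ r ∈ Finset.range N, W r ω) atTop (𝓝 0)} ∪
      {ω | ¬ Tendsto (∑ r ∈ Finset.range N, W r ω) atTop (𝓝 c)} := by
    refine exists_notMem_of_measure_lt_one (P := P) (lt_of_le_of_lt ?_ h34)
    exact (measure_union_le _ _).trans ((add_le_add (key N le_rfl) hc).trans le_self_add)
  simp only [Set.mem_union, Set.mem_ofPred_eq, not_or, not_not] at hω
  exact tendsto_nhds_unique hω.2 hω.1

end Concentration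

/-! ### Sample means and sample covariance matrices -/

section Sample

variable {p N : ℕ}

lemma sum_sub_sampleMean (z : Fin N → E p) : ∑ r, (z r - sampleMean z) = 0 := by
  rcases eq_or_ne N 0 with h | h
  · subst h; simp
  · rw [Finset.sum_sub_distrib, Finset.sum_const, Finset.card_univ, Fintype.card_fin, sampleMean,
      ← Nat.cast_smul_eq_nsmul ℝ, smul_smul, mul_inv_cancel₀ (by exact_mod_cast h), one_smul,
      sub_self]

lemma sampleMean_sub_const (hN : N ≠ 0) (z : Fin N → E p) (c : E p) :
    sampleMean z - c = (N : ℝ)⁻¹ • ∑ r, (z r - c) := by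
  rw [Finset.sum_sub_distrib, Finset.sum_const, Finset.card_univ, Fintype.card_fin, sampleMean,
    ← Nat.cast_smul_eq_nsmul ℝ, smul_sub, smul_smul, inv_mul_cancel₀ (by exact_mod_cast hN),
    one_smul]

lemma sampleCov_transpose (z : Fin N → E p) : (sampleCov z)ᵀ = sampleCov z := by
  ext i j
  simp only [Matrix.transpose_apply, sampleCov, Matrix.of_apply]
  congr 1
  exact Finset.sum_congr rfl fun r _ => mul_comm _ _

lemma trace_sampleCov (z : Fin N → E p) :
    (sampleCov z).trace = ((N : ℝ) - 1)⁻¹ * ∑ r, ‖z r - sampleMean z‖ ^ 2 := by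
  simp only [Matrix.trace, Matrix.diag, sampleCov, Matrix.of_apply, ← Finset.mul_sum]
  rw [Finset.sum_comm]
  congr 1
  refine Finset.sum_congr rfl fun r _ => ?_
  rw [EuclideanSpace.real_norm_sq_eq]
  exact Finset.sum_congr rfl fun i _ => by simp [sq]

lemma wnorm_sampleCov (z : Fin N → E p) (a : E p) :
    wnorm (sampleCov z) a = ((N : ℝ) - 1)⁻¹ * ∑ r, (inner ℝ a (z r - sampleMean z)) ^ 2 := by
  have h : ∀ r, inner ℝ a (z r - sampleMean z) = ∑ i, a i * (z r i - sampleMean z i) := by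
    intro r
    simp [PiLp.inner_apply, mul_comm]
  simp only [h, wnorm, dotProduct, Matrix.mulVec, sampleCov, Matrix.of_apply, sq, Finset.mul_sum,
    Finset.sum_mul]
  rw [Finset.sum_congr rfl fun i _ => Finset.sum_comm, Finset.sum_comm]
  refine Finset.sum_congr rfl fun r _ => ?_
  rw [Finset.sum_comm]
  refine Finset.sum_congr rfl fun i _ => Finset.sum_congr rfl fun j _ => ?_
  ring

lemma wnorm_sampleCov_le (hN : 1 ≤ N) (z : Fin N → E p) (a : E p) :
    wnorm (sampleCov z) a ≤ (sampleCov z).trace * ‖a‖ ^ 2 := by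
  have hN' : (0 : ℝ) ≤ ((N : ℝ) - 1)⁻¹ := by
    rw [inv_nonneg, sub_nonneg]; exact_mod_cast hN
  rw [wnorm_sampleCov, trace_sampleCov, mul_assoc, Finset.sum_mul]
  refine mul_le_mul_of_nonneg_left (Finset.sum_le_sum fun r _ => ?_) hN'
  rw [← mul_pow, ← sq_abs, mul_comm]
  exact pow_le_pow_left₀ (abs_nonneg _) (abs_real_inner_le_norm _ _) 2

lemma posSemidef_sampleCov (hN : 1 ≤ N) (z : Fin N → E p) : (sampleCov z).PosSemidef := by
  refine posSemidef_of_wnorm_nonneg (sampleCov_transpose z) fun a => ?_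
  have hN' : (0 : ℝ) ≤ ((N : ℝ) - 1)⁻¹ := by
    rw [inv_nonneg, sub_nonneg]; exact_mod_cast hN
  rw [wnorm_sampleCov]
  positivity

/-- Decomposition of the second moment about an arbitrary centre `c`. -/
lemma sum_sq_norm_sub (z : Fin N → E p) (c : E p) :
    ∑ r, ‖z r - c‖ ^ 2 =
      ∑ r, ‖z r - sampleMean z‖ ^ 2 + N * ‖sampleMean z - c‖ ^ 2 := by
  have h : ∀ r, ‖z r - c‖ ^ 2 = ‖z r - sampleMean z‖ ^ 2 +
      2 * inner ℝ (z r - sampleMean z) (sampleMean z - c) + ‖sampleMean z - c‖ ^ 2 := by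
    intro r
    rw [← norm_add_sq_real, sub_add_sub_cancel]
  simp only [h, Finset.sum_add_distrib, ← Finset.mul_sum, ← sum_inner, sum_sub_sampleMean]
  simp

end Sample

/-! ### The limiting covariance matrices are bounded on the parameter space -/

section Bounded

variable {p q : ℕ} {M : Model.{u₁, u₂, u₃} p q} {Ω : Type u₄} [MeasurableSpace Ω]
  {P : Measure Ω}

lemma Model.measurable_s (M : Model.{u₁, u₂, u₃} p q) (n : ℕ) {θ : E q} (hθ : θ ∈ M.Θ) :
    Measurable fun x : M.Seed n => M.s n x θ :=
  (M.measurable_stat n).comp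
    (((M.measurable_G n θ hθ).comp measurable_fst).prodMk measurable_snd)

lemma Model.Sampling.measurable_sr (𝒮 : M.Sampling P) (r n : ℕ) {θ : E q} (hθ : θ ∈ M.Θ) :
    Measurable fun ω => 𝒮.sr r n ω θ :=
  (M.measurable_s n hθ).comp (𝒮.measurable_seed n r)

/-- `Sig` is bounded on `Θ`, although `Θ` need not be compact.  If `tr Sig (θ k) → ∞`, then for a
large fixed `n` the normalized squares `n ‖sʳ(θ k) - b (θ k)‖² / ((Rₙ - 1) tr Sig (θ k))`, which
are independent over `r`, add up to a sequence tending to one as `k → ∞` with probability near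
one, by the uniform convergence of the simulated moments, whereas each of them tends to zero with
probability near one, by the uniform convergence of the statistic.  This contradicts
`eq_zero_of_tendsto_sum`. -/
lemma exists_trace_le [IsProbabilityMeasure P] {𝒮 : M.Sampling P} {θs : E q} {b : E q → E p}
    {Sig : E q → Matrix (Fin p) (Fin p) ℝ} {R : ℕ → ℕ} (hR : Tendsto R atTop atTop)
    (h3 : A3 𝒮 b) (h8 : A8 𝒮 R θs b Sig) : ∃ K : ℝ, ∀ θ ∈ M.Θ, (Sig θ).trace ≤ K := by
  by_contra! hcon
  choose θ hθ hT using fun k : ℕ => hcon (k + 1)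
  have hTlim : Tendsto (fun k => (Sig (θ k)).trace) atTop atTop :=
    tendsto_atTop_mono (fun k => (le_add_of_nonneg_right zero_le_one).trans (hT k).le)
      tendsto_natCast_atTop_atTop
  have hTpos : ∀ k, 0 < (Sig (θ k)).trace := fun k => lt_trans (by positivity) (hT k)
  have hcov : ∀ᶠ z in inProb P, ∀ i, ∀ a ∈ M.Θ,
      dist (𝒮.nSR (R z.1) z.1 z.2 a i i) (Sig a i i) < 1 :=
    eventually_all.2 fun i => uniformlyInProb_iff.1 (h8.cov_unif i i) 1 one_pos
  have hmean := uniformlyInProb_iff.1 h8.mean_unif 1 one_pos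
  have hstat := uniformlyInProb_iff.1 (h3 1) 1 one_pos
  have hE1 := ENNReal.tendsto_nhds_zero.1 (eventually_inProb.1 (hcov.and hmean)) 4⁻¹ (by simp)
  have hE2 := ENNReal.tendsto_nhds_zero.1 (eventually_inProb.1 hstat) 4⁻¹ (by simp)
  obtain ⟨n, hn1, hn2, hn3⟩ := (hE1.and (hE2.and (hR.eventually_ge_atTop 2))).exists
  have hRpos : (0 : ℝ) < (R n : ℝ) - 1 := by
    have : (2 : ℝ) ≤ R n := by exact_mod_cast hn3
    linarith
  let f : M.Seed n → ℕ → ℝ := fun x k =>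
    (n : ℝ) * ((R n : ℝ) - 1)⁻¹ * ‖M.s n x (θ k) - b (θ k)‖ ^ 2 / (Sig (θ k)).trace
  have hf : Measurable f := measurable_pi_lambda _ fun k =>
    ((((M.measurable_s n (hθ k)).sub_const _).norm.pow_const 2).const_mul _).div_const _
  let W : ℕ → Ω → ℕ → ℝ := fun r ω => f (𝒮.seed n (r + 1) ω)
  have hinv : Tendsto (fun k => (Sig (θ k)).trace⁻¹) atTop (𝓝 0) := hTlim.inv_tendsto_atTop
  have hA : MeasurableSet {x : M.Seed n | ¬ Tendsto (f x) atTop (𝓝 0)} :=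
    (measurableSet_tendsto (𝓝 (0 : ℝ)) fun k => (measurable_pi_apply k).comp hf).compl
  -- The events have the same probability for all `r` since the seeds are identically distributed.
  have hW0 : ∀ r, P {ω | ¬ Tendsto (W r ω) atTop (𝓝 0)} ≤ 4⁻¹ := by
    intro r
    have h1 : ∀ r', P {ω | ¬ Tendsto (f (𝒮.seed n r' ω)) atTop (𝓝 0)} =
        ((M.Fu n).prod (M.FDP n)) {x : M.Seed n | ¬ Tendsto (f x) atTop (𝓝 0)} := by
      intro r'
      rw [← 𝒮.law_seed n r', Measure.map_apply (𝒮.measurable_seed n r') hA]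
      rfl
    change P {ω | ¬ Tendsto (f (𝒮.seed n (r + 1) ω)) atTop (𝓝 0)} ≤ 4⁻¹
    rw [h1, ← h1 1]
    refine (measure_mono ?_).trans hn2
    intro ω hω hn
    refine hω ?_
    have hlim := hinv.const_mul ((n : ℝ) * ((R n : ℝ) - 1)⁻¹)
    rw [mul_zero] at hlim
    refine squeeze_zero (fun k => ?_) (fun k => ?_) hlim
    · have := hTpos k
      positivity
    · have h2 := hn (θ k) (hθ k)
      rw [dist_eq_norm] at h2
      have h3 : ‖M.s n (𝒮.seed n 1 ω) (θ k) - b (θ k)‖ ^ 2 ≤ 1 :=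
        pow_le_one₀ (norm_nonneg _) h2.le
      simp only [f, div_eq_mul_inv]
      have := inv_pos.2 (hTpos k)
      have := inv_pos.2 hRpos
      calc _ ≤ (n : ℝ) * ((R n : ℝ) - 1)⁻¹ * 1 * (Sig (θ k)).trace⁻¹ := by gcongr
        _ = _ := by ring
  have hW1 : P {ω | ¬ Tendsto (∑ r ∈ Finset.range (R n), W r ω) atTop (𝓝 1)} ≤ 4⁻¹ := by
    refine (measure_mono ?_).trans hn1
    intro ω hω hn
    refine hω ?_
    obtain ⟨hn, hm⟩ := hn
    have hkey : ∀ k, |(∑ r ∈ Finset.range (R n), W r ω) k - 1| ≤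
        (p + n * ((R n : ℝ) - 1)⁻¹ * R n) * (Sig (θ k)).trace⁻¹ := by
      intro k
      set z : Fin (R n) → E p := fun r => M.s n (𝒮.sim (R n) n ω r) (θ k) with hz
      have h1 : (∑ r ∈ Finset.range (R n), W r ω) k =
          n * ((R n : ℝ) - 1)⁻¹ * (∑ r, ‖z r - b (θ k)‖ ^ 2) * (Sig (θ k)).trace⁻¹ := by
        rw [Finset.sum_apply, Finset.sum_range (n := R n) fun r => W r ω k, Finset.mul_sum,
          Finset.sum_mul]
        rfl
      have h2 : (𝒮.nSR (R n) n ω (θ k)).trace =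
          n * ((R n : ℝ) - 1)⁻¹ * ∑ r, ‖z r - sampleMean z‖ ^ 2 := by
        have : 𝒮.nSR (R n) n ω (θ k) = (n : ℝ) • sampleCov z := rfl
        rw [this, Matrix.trace_smul, trace_sampleCov, smul_eq_mul, mul_assoc]
      have h3 : ‖sampleMean z - b (θ k)‖ < 1 := by
        have := hm (θ k) (hθ k)
        rwa [dist_eq_norm] at this
      have h4 : |(𝒮.nSR (R n) n ω (θ k)).trace - (Sig (θ k)).trace| ≤ p := by
        rw [Matrix.trace, Matrix.trace, ← Finset.sum_sub_distrib]
        refine (Finset.abs_sum_le_sum_abs _ _).trans ?_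
        calc _ ≤ ∑ _i : Fin p, (1 : ℝ) := Finset.sum_le_sum fun i _ => (hn i (θ k) (hθ k)).le
          _ = p := by simp
      have hTk := hTpos k
      rw [h1, sum_sq_norm_sub z]
      have h5 : n * ((R n : ℝ) - 1)⁻¹ * (∑ r, ‖z r - sampleMean z‖ ^ 2 +
            R n * ‖sampleMean z - b (θ k)‖ ^ 2) * (Sig (θ k)).trace⁻¹ - 1 =
          (((𝒮.nSR (R n) n ω (θ k)).trace - (Sig (θ k)).trace) +
            n * ((R n : ℝ) - 1)⁻¹ * R n * ‖sampleMean z - b (θ k)‖ ^ 2) *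
            (Sig (θ k)).trace⁻¹ := by
        rw [h2]
        field_simp
        ring
      rw [h5, abs_mul, abs_of_pos (inv_pos.2 hTk)]
      have := inv_pos.2 hRpos
      have h6 : ‖sampleMean z - b (θ k)‖ ^ 2 ≤ 1 := pow_le_one₀ (norm_nonneg _) h3.le
      gcongr
      refine (abs_add_le _ _).trans (add_le_add h4 ?_)
      rw [abs_of_nonneg (by positivity)]
      calc _ ≤ (n : ℝ) * ((R n : ℝ) - 1)⁻¹ * R n * 1 := by gcongr
        _ = _ := mul_one _
    have hlim := hinv.const_mul (p + n * ((R n : ℝ) - 1)⁻¹ * R n)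
    rw [mul_zero] at hlim
    rw [← tendsto_sub_nhds_zero_iff]
    exact squeeze_zero_norm hkey hlim
  have hind : iIndepFun W P :=
    ((𝒮.indep_seed n).precomp (g := fun r => r + 1) (add_left_injective 1)).comp (fun _ => f)
      fun _ => hf
  exact one_ne_zero (eq_zero_of_tendsto_sum
    (fun r => hf.comp (𝒮.measurable_seed n (r + 1))) hind hW0 hW1)

end Bounded

/-! ### Weighted least squares and the Gauss–Markov bound -/

section GaussMarkov

variable {p q : ℕ}

lemma mulVec_injective_of_rank {B : Matrix (Fin p) (Fin q) ℝ} (hB : B.rank = q) :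
    Function.Injective B.mulVec := by
  rw [← Matrix.coe_mulVecLin, ← LinearMap.ker_eq_bot, ← Submodule.finrank_eq_zero]
  have h := LinearMap.finrank_range_add_finrank_ker B.mulVecLin
  rw [Module.finrank_fin_fun] at h
  rw [Matrix.rank] at hB
  omega

lemma exists_norm_le_norm_act {B : Matrix (Fin p) (Fin q) ℝ} (hB : B.rank = q) :
    ∃ c : ℝ, 0 < c ∧ ∀ x : E q, ‖x‖ ≤ c * ‖act B x‖ := by
  have hker : LinearMap.ker (matCLM B).toLinearMap = ⊥ := by
    rw [LinearMap.ker_eq_bot]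
    intro x y hxy
    exact WithLp.ofLp_injective 2 (mulVec_injective_of_rank hB (WithLp.toLp_injective 2 hxy))
  obtain ⟨K, hK0, hK⟩ := LinearMap.exists_antilipschitzWith _ hker
  refine ⟨K, by exact_mod_cast hK0, fun x => ?_⟩
  simpa using hK.le_mul_dist x 0

variable {B : Matrix (Fin p) (Fin q) ℝ} {W V : Matrix (Fin p) (Fin p) ℝ}

lemma posDef_transpose_mul_mul (hB : B.rank = q) (hW : W.PosDef) : (Bᵀ * W * B).PosDef := by
  simpa using hW.conjTranspose_mul_mul_same (mulVec_injective_of_rank hB)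

lemma isUnit_det_transpose_mul_mul (hB : B.rank = q) (hW : W.PosDef) :
    IsUnit (Bᵀ * W * B).det :=
  (Matrix.isUnit_iff_isUnit_det _).1 (posDef_transpose_mul_mul hB hW).isUnit

lemma wls_mul_self (hB : B.rank = q) (hW : W.PosDef) : wls B W * B = 1 := by
  rw [wls, Matrix.mul_assoc, Matrix.mul_assoc, ← Matrix.mul_assoc Bᵀ,
    Matrix.nonsing_inv_mul _ (isUnit_det_transpose_mul_mul hB hW)]

/-- With the efficient weight `V⁻¹`, the covariance between `wls B V⁻¹ X` and any other linear
unbiased estimator `D X` (so `D B = 1`) is `(Bᵀ V⁻¹ B)⁻¹`, where `V` is the covariance of `X`. -/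
lemma wls_mul_mul_transpose (hV : V.PosDef) {D : Matrix (Fin q) (Fin p) ℝ} (hD : D * B = 1) :
    wls B V⁻¹ * V * Dᵀ = (Bᵀ * V⁻¹ * B)⁻¹ := by
  have hu : IsUnit V.det := (Matrix.isUnit_iff_isUnit_det _).1 hV.isUnit
  have hD' : Bᵀ * Dᵀ = 1 := by rw [← Matrix.transpose_mul, hD, Matrix.transpose_one]
  rw [wls, Matrix.mul_assoc _ V⁻¹ V, Matrix.nonsing_inv_mul _ hu, Matrix.mul_one, Matrix.mul_assoc,
    hD', Matrix.mul_one]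

lemma wls_mul_mul_wls_transpose (hB : B.rank = q) (hV : V.PosDef) :
    wls B V⁻¹ * V * (wls B V⁻¹)ᵀ = (Bᵀ * V⁻¹ * B)⁻¹ :=
  wls_mul_mul_transpose hV (wls_mul_self hB hV.inv)

/-- The Gauss–Markov inequality: `D V Dᵀ` exceeds `(Bᵀ V⁻¹ B)⁻¹` by the covariance matrix of the
difference of the two estimators. -/
lemma posSemidef_gaussMarkov (hB : B.rank = q) (hV : V.PosDef) {D : Matrix (Fin q) (Fin p) ℝ}
    (hD : D * B = 1) : (D * V * Dᵀ - (Bᵀ * V⁻¹ * B)⁻¹).PosSemidef := by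
  have h1 := wls_mul_mul_transpose hV hD
  have h2 := wls_mul_mul_wls_transpose hB hV
  have hVt : Vᵀ = V := by simpa [Matrix.IsHermitian] using hV.isHermitian
  have h3 : D * V * (wls B V⁻¹)ᵀ = (Bᵀ * V⁻¹ * B)⁻¹ := by
    have h4 := congrArg Matrix.transpose h1
    have h5 : ((Bᵀ * V⁻¹ * B)⁻¹)ᵀ = (Bᵀ * V⁻¹ * B)⁻¹ := by
      simpa [Matrix.IsHermitian] using (posDef_transpose_mul_mul hB hV.inv).inv.isHermitian
    rw [h5] at h4
    rw [← h4]
    simp [Matrix.transpose_mul, hVt, Matrix.mul_assoc]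
  have h6 : D * V * Dᵀ - (Bᵀ * V⁻¹ * B)⁻¹ = (D - wls B V⁻¹) * V * (D - wls B V⁻¹)ᵀ := by
    rw [Matrix.transpose_sub, Matrix.mul_sub, Matrix.sub_mul, Matrix.sub_mul, Matrix.sub_mul, h1,
      h2, h3]
    abel
  rw [h6]
  simpa using hV.posSemidef.mul_mul_conjTranspose_same (D - wls B V⁻¹)

end GaussMarkov

/-! ### Minimum distance estimators -/

section MinimumDistance

variable {p q : ℕ} {ι : Type*} {l : Filter ι} {m : ι → E q → E p} {s : ι → E p} {t : ι → E q}
  {θs : E q}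

/-- Consistency of an estimator `t` whose residual `s - m(t)` is at most a constant times the
residual at `θs`, when `m` is uniformly close to `b` and the inverse of `b` is continuous at
`b θs`. -/
lemma tendsto_of_minimum_distance {Θ : Set (E q)} {b : E q → E p} (hθs : θs ∈ Θ)
    (hinv : ∀ ε : ℝ, 0 < ε → ∃ δ : ℝ, 0 < δ ∧ ∀ θ ∈ Θ, ε ≤ ‖θ - θs‖ → δ ≤ ‖b θ - b θs‖)
    (ht : ∀ z, t z ∈ Θ) (hs : Tendsto s l (𝓝 (b θs)))
    (hm : ∀ t' : ι → E q, (∀ z, t' z ∈ Θ) → Tendsto (fun z => m z (t' z) - b (t' z)) l (𝓝 0))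
    {C : ℝ} (hC : ∀ᶠ z in l, ‖s z - m z (t z)‖ ≤ C * ‖s z - m z θs‖) :
    Tendsto t l (𝓝 θs) := by
  have h1 : Tendsto (fun z => s z - m z θs) l (𝓝 0) := by
    have := (tendsto_sub_nhds_zero_iff.2 hs).sub (hm (fun _ => θs) fun _ => hθs)
    simpa using this
  have h2 : Tendsto (fun z => s z - m z (t z)) l (𝓝 0) := by
    refine squeeze_zero_norm' hC ?_
    simpa using h1.norm.const_mul C
  have h3 : Tendsto (fun z => b (t z) - b θs) l (𝓝 0) := by
    have := ((tendsto_sub_nhds_zero_iff.2 hs).sub h2).sub (hm t ht)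
    simp only [sub_zero] at this
    refine this.congr fun z => ?_
    abel
  rw [Metric.tendsto_nhds]
  intro ε hε
  obtain ⟨δ, hδ, h⟩ := hinv ε hε
  filter_upwards [Metric.tendsto_nhds.1 h3 δ hδ] with z hz
  rw [dist_zero_right] at hz
  rw [dist_eq_norm]
  by_contra hc
  exact absurd (h _ (ht z) (not_lt.1 hc)) (not_le.2 hz)

/-- The linear representation of a minimum distance estimator `t` of `θs` that solves the estimating
equation `(∂m/∂θ)ᵀ A (s - m(t)) = 0` up to a negligible error, at rate `r`. -/
lemma linearization_of_minimum_distance {r : ι → ℝ} {A : ι → Matrix (Fin p) (Fin p) ℝ}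
    {W : Matrix (Fin p) (Fin p) ℝ} {b : E q → E p} {U : Set (E q)} (hU : U ∈ 𝓝 θs)
    (hW : W.PosDef) (hB : (jacobian b θs).rank = q)
    (hdiff : ∀ z, ∀ θ ∈ U, DifferentiableAt ℝ (m z) θ)
    (hder : ∀ ξ : ι → E q, Tendsto ξ l (𝓝 θs) →
      Tendsto (fun z => fderiv ℝ (m z) (ξ z)) l (𝓝 (fderiv ℝ b θs)))
    (hA : Tendsto A l (𝓝 W)) (ht : Tendsto t l (𝓝 θs))
    (hs : IsOp l fun z => r z • (s z - m z θs))
    {C : ℝ} (hC : ∀ᶠ z in l, ‖s z - m z (t z)‖ ≤ C * ‖s z - m z θs‖)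
    (hfoc : Tendsto (fun z => act (jacobian (m z) (t z))ᵀ (act (A z) (r z • (s z - m z (t z)))))
      l (𝓝 0)) :
    Tendsto (fun z => r z • (t z - θs) - act (wls (jacobian b θs) W) (r z • (s z - m z θs)))
      l (𝓝 0) := by
  set B := jacobian b θs with hBdef
  have hres : IsOp l fun z => r z • (s z - m z (t z)) := by
    refine hs.of_le C ?_
    filter_upwards [hC] with z hz
    rw [norm_smul, norm_smul, mul_left_comm]
    gcongr
  obtain ⟨δ, hδ, hlin⟩ := exists_linearization hU hdiff hder ht
  obtain ⟨c, hc, hcB⟩ := exists_norm_le_norm_act hB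
  have hmdiff : IsOp l fun z => r z • (m z (t z) - m z θs) := by
    refine (hs.sub hres).congr' (Eventually.of_forall fun z => ?_)
    simp only [← smul_sub]
    congr 1
    abel
  -- The estimator is `r`-consistent because `B` is bounded below.
  have htOp : IsOp l fun z => r z • (t z - θs) := by
    refine hmdiff.of_le (2 * c) ?_
    filter_upwards [hlin, hδ.eventually_lt_const (show (0 : ℝ) < (2 * c)⁻¹ by positivity)]
      with z h1 h2
    rw [norm_smul, norm_smul, mul_left_comm]
    refine mul_le_mul_of_nonneg_left ?_ (norm_nonneg _)
    have h3 := hcB (t z - θs)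
    rw [act_jacobian] at h3
    have h4 : ‖fderiv ℝ b θs (t z - θs)‖ ≤ ‖m z (t z) - m z θs‖ + (2 * c)⁻¹ * ‖t z - θs‖ := by
      have h5 := norm_sub_le (m z (t z) - m z θs)
        (m z (t z) - m z θs - fderiv ℝ b θs (t z - θs))
      rw [sub_sub_cancel] at h5
      refine h5.trans (add_le_add le_rfl (h1.trans ?_))
      gcongr
    have h6 : c * ((2 * c)⁻¹ * ‖t z - θs‖) = ‖t z - θs‖ / 2 := by field_simp
    nlinarith
  have hrem : Tendsto (fun z => r z • (m z (t z) - m z θs - fderiv ℝ b θs (t z - θs))) l (𝓝 0) := by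
    refine htOp.tendsto_zero_of_le hδ ?_
    filter_upwards [hlin] with z hz
    rw [norm_smul, norm_smul, mul_left_comm]
    gcongr
  have hJ := tendsto_jacobian_of_fderiv (hder t ht)
  have hJA : Tendsto (fun z => (jacobian (m z) (t z))ᵀ * A z) l (𝓝 (Bᵀ * W)) :=
    tendsto_matrix_mul ((continuous_id.matrix_transpose.tendsto _).comp hJ) hA
  have hscore : Tendsto (fun z => act (Bᵀ * W) (r z • (s z - m z (t z)))) l (𝓝 0) := by
    have h1 := hfoc.sub (hres.tendsto_act_sub hJA)
    rw [sub_zero] at h1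
    refine h1.congr fun z => ?_
    rw [act_mul _ (A z)]
    abel
  have hu := isUnit_det_transpose_mul_mul hB hW
  have h1 := tendsto_act (tendsto_const_nhds (x := (Bᵀ * W * B)⁻¹)) hscore
  have h2 := tendsto_act (tendsto_const_nhds (x := wls B W)) hrem
  have h3 := (h1.add h2).neg
  simp only [act_zero, add_zero, neg_zero] at h3
  refine h3.congr fun z => ?_
  have h4 : act (Bᵀ * W * B)⁻¹ (act (Bᵀ * W) (r z • (s z - m z (t z)))) =
      act (wls B W) (r z • (s z - m z (t z))) := by
    rw [← act_mul, wls, Matrix.mul_assoc (Bᵀ * W * B)⁻¹]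
  have h5 : act (wls B W) (fderiv ℝ b θs (t z - θs)) = t z - θs := by
    rw [← act_jacobian, ← act_mul, wls_mul_self hB hW, act_one]
  rw [h4]
  simp only [act_smul, act_sub, h5]
  module

end MinimumDistance

/-! ### The score of the adaptively weighted objective -/

section Score

variable {p q : ℕ}

lemma differentiableAt_det {F : Type*} [NormedAddCommGroup F] [NormedSpace ℝ F] {k : ℕ}
    {S : F → Matrix (Fin k) (Fin k) ℝ} {t : F}
    (hS : ∀ i j, DifferentiableAt ℝ (fun θ => S θ i j) t) :
    DifferentiableAt ℝ (fun θ => (S θ).det) t := by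
  simp only [Matrix.det_apply]
  refine DifferentiableAt.fun_sum fun σ _ => ?_
  refine DifferentiableAt.fun_const_smul ?_ _
  exact (HasFDerivAt.finsetProd fun i _ => (hS (σ i) i).hasFDerivAt).differentiableAt

lemma differentiableAt_inv_apply {F : Type*} [NormedAddCommGroup F] [NormedSpace ℝ F] {k : ℕ}
    {S : F → Matrix (Fin k) (Fin k) ℝ} {t : F}
    (hS : ∀ i j, DifferentiableAt ℝ (fun θ => S θ i j) t) (hu : IsUnit (S t).det) (i j : Fin k) :
    DifferentiableAt ℝ (fun θ => (S θ)⁻¹ i j) t := by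
  simp only [Matrix.inv_def, Ring.inverse_eq_inv', Matrix.smul_apply, smul_eq_mul,
    Matrix.adjugate_apply]
  refine ((differentiableAt_det hS).fun_inv hu.ne_zero).fun_mul (differentiableAt_det fun a c => ?_)
  by_cases h : a = j
  · simp [h, Matrix.updateRow_apply]
  · simpa [h, Matrix.updateRow_apply] using hS a c

/-- The first order condition for a local minimizer of `θ ↦ x(θ)ᵀ S(θ)⁻¹ x(θ)`.  The derivative of
the inverse is avoided by the envelope `x ᵀ S⁻¹ x = max_y (2 xᵀ y - yᵀ S y)`, attained at
`y = S⁻¹ x`. -/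
lemma score_of_isLocalMin {S : E q → Matrix (Fin p) (Fin p) ℝ} {x : E q → E p} {t : E q}
    (hS : ∀ i j, DifferentiableAt ℝ (fun θ => S θ i j) t) (hx : DifferentiableAt ℝ x t)
    (hu : IsUnit (S t).det) (hpsd : ∀ᶠ θ in 𝓝 t, (S θ).PosSemidef)
    (hmin : IsLocalMin (fun θ => wnorm (S θ)⁻¹ (x θ)) t) (h : E q) :
    2 * inner ℝ (fderiv ℝ x t h) (act (S t)⁻¹ (x t)) =
      ∑ i, ∑ j, act (S t)⁻¹ (x t) i * (fderiv ℝ (fun θ => S θ i j) t h * act (S t)⁻¹ (x t) j) := by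
  set y := act (S t)⁻¹ (x t) with hy
  let f : E q → ℝ := fun θ => wnorm (S θ)⁻¹ (x θ)
  let g : E q → ℝ := fun θ => 2 * inner ℝ (x θ) y - wnorm (S θ) y
  have hxi : ∀ i, DifferentiableAt ℝ (fun θ => x θ i) t := fun i =>
    (EuclideanSpace.proj (𝕜 := ℝ) i).differentiableAt.comp t hx
  have hf : DifferentiableAt ℝ f t := by
    simp only [f, wnorm, dotProduct, Matrix.mulVec]
    refine DifferentiableAt.fun_sum fun i _ => (hxi i).fun_mul ?_
    exact DifferentiableAt.fun_sum fun j _ => (differentiableAt_inv_apply hS hu i j).fun_mul (hxi j)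
  have hwy : HasFDerivAt (fun θ => wnorm (S θ) y)
      (∑ i, ∑ j, (y i * y j) • fderiv ℝ (fun θ => S θ i j) t) t := by
    have h1 : (fun θ => wnorm (S θ) y) = fun θ => ∑ i, ∑ j, (y i * y j) * S θ i j := by
      funext θ
      simp only [wnorm, dotProduct, Matrix.mulVec, Finset.mul_sum]
      exact Finset.sum_congr rfl fun i _ => Finset.sum_congr rfl fun j _ => by ring
    rw [h1]
    refine HasFDerivAt.fun_sum fun i _ => HasFDerivAt.fun_sum fun j _ => ?_
    exact (hS i j).hasFDerivAt.const_mul _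
  have hxy : HasFDerivAt (fun θ => inner ℝ (x θ) y) ((innerSL ℝ y).comp (fderiv ℝ x t)) t := by
    have h1 : (fun θ => inner ℝ (x θ) y) = fun θ => innerSL ℝ y (x θ) := by
      funext θ; rw [innerSL_apply_apply, real_inner_comm]
    rw [h1]
    exact (innerSL ℝ y).hasFDerivAt.comp t hx.hasFDerivAt
  have hg := (hxy.const_mul 2).sub hwy
  have hudet : ∀ᶠ θ in 𝓝 t, IsUnit (S θ).det := by
    filter_upwards [(differentiableAt_det hS).continuousAt.eventually_ne hu.ne_zero] with θ hθ
    exact isUnit_iff_ne_zero.2 hθ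
  have hle : ∀ᶠ θ in 𝓝 t, g θ ≤ f θ := by
    filter_upwards [hudet, hpsd] with θ h1 h2
    have hsym : (S θ)ᵀ = S θ := by simpa [Matrix.IsHermitian] using h2.isHermitian
    set w := act (S θ)⁻¹ (x θ) with hw
    have hSw : act (S θ) w = x θ := by rw [hw, ← act_mul, Matrix.mul_nonsing_inv _ h1, act_one]
    have h3 := wnorm_nonneg h2 (w - y)
    have h4 : inner ℝ w (act (S θ) y) = inner ℝ (x θ) y := by
      rw [inner_act, hsym, hSw]
    have h5 : f θ = inner ℝ (x θ) w := wnorm_eq_inner _ _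
    rw [wnorm_eq_inner, act_sub, hSw, inner_sub_left, inner_sub_right, inner_sub_right, h4,
      ← wnorm_eq_inner, real_inner_comm, real_inner_comm (x θ) y] at h3
    simp only [g, h5]
    linarith
  have heq : g t = f t := by
    have hSy : act (S t) y = x t := by rw [hy, ← act_mul, Matrix.mul_nonsing_inv _ hu, act_one]
    have h1 : f t = inner ℝ (x t) y := wnorm_eq_inner _ _
    simp only [g]
    rw [h1, wnorm_eq_inner, hSy, real_inner_comm (x t) y]
    ring
  have hmin2 : IsLocalMin (fun θ => f θ - g θ) t := by
    filter_upwards [hle] with θ hθ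
    simp only [heq, sub_self, sub_nonneg, hθ]
  have hd1 := hmin.fderiv_eq_zero
  have hd2 := hmin2.fderiv_eq_zero
  have hd3 : fderiv ℝ (fun θ => f θ - g θ) t = fderiv ℝ f t - fderiv ℝ g t :=
    fderiv_fun_sub hf hg.differentiableAt
  rw [hd2, hd1, zero_sub, eq_comm, neg_eq_zero] at hd3
  have hd4 := congrArg (fun L : E q →L[ℝ] ℝ => L h) (hg.fderiv.symm.trans hd3)
  simp only [_root_.sub_apply, _root_.smul_apply,
    ContinuousLinearMap.comp_apply, _root_.sum_apply, innerSL_apply_apply,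
    _root_.zero_apply, smul_eq_mul, sub_eq_zero] at hd4
  rw [real_inner_comm, hd4]
  exact Finset.sum_congr rfl fun i _ => Finset.sum_congr rfl fun j _ => by ring

end Score

/-! ### The adaptive indirect estimator -/

section Estimators

variable {p q : ℕ} {M : Model.{u₁, u₂, u₃} p q} {Ω : Type u₄} [MeasurableSpace Ω]
  {P : Measure Ω} {𝒮 : M.Sampling P} {θs : E q} {ρinf : E p → E q → ℝ} {b : E q → E p}
  {Sig : E q → Matrix (Fin p) (Fin p) ℝ} {R : ℕ → ℕ}

lemma A5.differentiableAt_s (h5 : A5 𝒮 θs b) (n : ℕ) (x : M.Seed n) {θ : E q}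
    (hθ : θ ∈ interior M.Θ) : DifferentiableAt ℝ (M.s n x) θ :=
  ((h5.contDiffOn_s n x).differentiableOn one_ne_zero).differentiableAt
    (isOpen_interior.mem_nhds hθ)

lemma A5.differentiableAt_m (h5 : A5 𝒮 θs b) (n : ℕ) {N : ℕ} (x : Fin N → M.Seed n) {θ : E q}
    (hθ : θ ∈ interior M.Θ) : DifferentiableAt ℝ (M.m n x) θ :=
  (DifferentiableAt.fun_sum fun r _ => h5.differentiableAt_s n (x r) hθ).fun_const_smul _

lemma differentiableAt_apply {f : E q → E p} {θ : E q} (hf : DifferentiableAt ℝ f θ) (i : Fin p) :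
    DifferentiableAt ℝ (fun θ => f θ i) θ :=
  (EuclideanSpace.proj (𝕜 := ℝ) i).differentiableAt.comp θ hf

lemma A5.differentiableAt_smul_S (h5 : A5 𝒮 θs b) (n : ℕ) {N : ℕ} (x : Fin N → M.Seed n) {θ : E q}
    (hθ : θ ∈ interior M.Θ) (i j : Fin p) :
    DifferentiableAt ℝ (fun θ => ((n : ℝ) • M.S n x θ) i j) θ := by
  have h : ∀ r k, DifferentiableAt ℝ
      (fun θ => M.s n (x r) θ k - sampleMean (fun r => M.s n (x r) θ) k) θ := fun r k =>
    (differentiableAt_apply (h5.differentiableAt_s n (x r) hθ) k).fun_sub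
      (differentiableAt_apply (h5.differentiableAt_m n x hθ) k)
  exact ((DifferentiableAt.fun_sum fun r _ => (h r i).fun_mul (h r j)).const_mul _).const_mul _

/-- The minimizing property of the adaptive indirect estimator in terms of `n S^R`, which has a
nonsingular limit. -/
lemma Model.IsADI.isUnit_det_and_wnorm_le {adi : ∀ n, E p → (Fin (R n) → M.Seed n) → E q}
    (hadi : M.IsADI R adi) {n : ℕ} (hn : n ≠ 0) {s : E p} (hs : s ∈ M.𝔹)
    (x : Fin (R n) → M.Seed n) {θ : E q} (hθ : θ ∈ M.Θ)
    (hu : IsUnit ((n : ℝ) • M.S n x θ).det) :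
    IsUnit ((n : ℝ) • M.S n x (adi n s x)).det ∧
      wnorm ((n : ℝ) • M.S n x (adi n s x))⁻¹ (s - M.m n x (adi n s x)) ≤
        wnorm ((n : ℝ) • M.S n x θ)⁻¹ (s - M.m n x θ) := by
  have hn' : IsUnit (n : ℝ) := isUnit_iff_ne_zero.2 (by exact_mod_cast hn)
  have hdet : ∀ A : Matrix (Fin p) (Fin p) ℝ, IsUnit ((n : ℝ) • A).det ↔ IsUnit A.det := by
    intro A
    rw [Matrix.det_smul, IsUnit.mul_iff, and_iff_right (hn'.pow _)]
  have hinv : ∀ A : Matrix (Fin p) (Fin p) ℝ, IsUnit A.det →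
      ((n : ℝ) • A)⁻¹ = (n : ℝ)⁻¹ • A⁻¹ := fun A hA => by
    simpa [Units.smul_def] using Matrix.inv_smul' A hn'.unit hA
  have h1 := hadi.isMin n s hs x hθ
  rw [hdet] at hu ⊢
  simp only [Set.mem_ofPred_eq, Model.adiObjective, if_pos hu] at h1
  by_cases hut : IsUnit (M.S n x (adi n s x)).det
  · refine ⟨hut, ?_⟩
    rw [if_pos hut, EReal.coe_le_coe_iff] at h1
    rw [hinv _ hu, hinv _ hut, wnorm_smul_left, wnorm_smul_left]
    gcongr
  · rw [if_neg hut] at h1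
    exact absurd h1 (by simp)

lemma Model.Sampling.obs_mem (𝒮 : M.Sampling P) (n : ℕ) (ω : Ω) (θ : E q) :
    𝒮.obs n ω θ ∈ M.𝔹 :=
  M.stat_mem _ _ _

lemma posSemidef_smul_S {n N : ℕ} (hN : 1 ≤ N) (x : Fin N → M.Seed n) (θ : E q) :
    ((n : ℝ) • M.S n x θ).PosSemidef :=
  (posSemidef_sampleCov hN _).smul (by positivity)

lemma norm_le_mul_norm_of_sq_le {F : Type*} [SeminormedAddCommGroup F] {x y : F} {D : ℝ}
    (h : ‖x‖ ^ 2 ≤ D * ‖y‖ ^ 2) : ‖x‖ ≤ (|D| + 1) * ‖y‖ := by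
  refine (sq_le_sq₀ (norm_nonneg _) (by positivity)).1 ?_
  rw [mul_pow]
  refine h.trans (mul_le_mul_of_nonneg_right ?_ (sq_nonneg _))
  nlinarith [le_abs_self D, abs_nonneg D]

/-- A quadratic error in the first order condition is negligible: if `y → 0` while `r y`
and `D` are stochastically bounded, then `r yᵀ D y → 0`. -/
lemma tendsto_score_of_foc {ι : Type*} {l : Filter ι} {r : ι → ℝ} {J : ι → Matrix (Fin p) (Fin q) ℝ}
    {y : ι → E p} {D : ι → Fin p → Fin p → (E q →L[ℝ] ℝ)} (hy0 : Tendsto y l (𝓝 0))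
    (hyOp : IsOp l fun z => r z • y z) (hD : ∀ i j, IsOp l fun z => D z i j)
    (hfoc : ∀ᶠ z in l, ∀ h, 2 * inner ℝ (act (J z) h) (y z) =
      -∑ i, ∑ j, y z i * (D z i j h * y z j)) :
    Tendsto (fun z => act (J z)ᵀ (r z • y z)) l (𝓝 0) := by
  have hprod : ∀ h : E q, Tendsto (fun z => ∑ i, ∑ j, r z * (y z i * (D z i j h * y z j)))
      l (𝓝 0) := by
    intro h
    rw [show (0 : ℝ) = ∑ _i : Fin p, ∑ _j : Fin p, 0 by simp]
    refine tendsto_finsetSum _ fun i _ => tendsto_finsetSum _ fun j _ => ?_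
    have h1 := (hD i j) _ (hyOp _ (tendsto_zero_iff_norm_tendsto_zero.1 hy0))
    have h2 := h1.mul_const ‖h‖
    rw [zero_mul] at h2
    refine squeeze_zero_norm (fun z => ?_) h2
    rw [norm_mul, norm_mul, norm_mul]
    calc _ ≤ ‖r z‖ * (‖y z‖ * (‖D z i j‖ * ‖h‖ * ‖y z‖)) := by
          gcongr
          · exact PiLp.norm_apply_le _ _
          · exact ContinuousLinearMap.le_opNorm _ _
          · exact PiLp.norm_apply_le _ _
      _ = _ := by rw [norm_smul]; ring
  have h13 : Tendsto (fun z => WithLp.ofLp (act (J z)ᵀ (r z • y z))) l (𝓝 0) := by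
    refine tendsto_pi_nhds.2 fun k => ?_
    have h14 := (hprod (EuclideanSpace.single k 1)).const_mul (-2⁻¹)
    rw [mul_zero] at h14
    refine h14.congr' ?_
    filter_upwards [hfoc] with z hz
    have h12 : ∀ v : E q, v k = inner ℝ (EuclideanSpace.single k (1 : ℝ)) v := by
      intro v; simp [EuclideanSpace.inner_single_left]
    rw [h12, act_smul, real_inner_smul_right, inner_act, Matrix.transpose_transpose]
    have h15 := hz (EuclideanSpace.single k 1)
    simp only [← Finset.mul_sum] at h15 ⊢
    linear_combination (-(r z) / 2) * h15
  exact ((PiLp.continuous_toLp 2 _).tendsto _).comp h13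

/-- The first order condition of the adaptive indirect estimator. -/
lemma Model.IsADI.foc {adi : ∀ n, E p → (Fin (R n) → M.Seed n) → E q}
    (hadi : M.IsADI R adi) (h5 : A5 𝒮 θs b) {n : ℕ} (hn : n ≠ 0) (hRn : 1 ≤ R n) {s : E p}
    (hs : s ∈ M.𝔹) (x : Fin (R n) → M.Seed n) {t : E q} (ht : t = adi n s x)
    (hti : t ∈ interior M.Θ) (hu : IsUnit ((n : ℝ) • M.S n x t).det) (h : E q) :
    2 * inner ℝ (act (jacobian (M.m n x) t) h)
        (act ((n : ℝ) • M.S n x t)⁻¹ (s - M.m n x t)) =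
      -∑ i, ∑ j, act ((n : ℝ) • M.S n x t)⁻¹ (s - M.m n x t) i *
        (fderiv ℝ (fun θ => ((n : ℝ) • M.S n x θ) i j) t h *
          act ((n : ℝ) • M.S n x t)⁻¹ (s - M.m n x t) j) := by
  have hdS := h5.differentiableAt_smul_S n x hti
  have hdm := h5.differentiableAt_m n x hti
  have hmin : IsLocalMin (fun θ => wnorm ((n : ℝ) • M.S n x θ)⁻¹ (s - M.m n x θ)) t := by
    filter_upwards [(differentiableAt_det hdS).continuousAt.eventually_ne hu.ne_zero,
      mem_interior_iff_mem_nhds.1 hti] with θ h10 h11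
    have := (hadi.isUnit_det_and_wnorm_le hn hs x h11 (isUnit_iff_ne_zero.2 h10)).2
    rwa [← ht] at this
  have hsc := score_of_isLocalMin hdS (hdm.const_sub s) hu
    (Eventually.of_forall fun θ => posSemidef_smul_S hRn x θ) hmin h
  rw [fderiv_const_sub, _root_.neg_apply, inner_neg_left, mul_neg] at hsc
  rw [act_jacobian, ← hsc, neg_neg]

section ADI

variable {adi : ∀ n, E p → (Fin (R n) → M.Seed n) → E q} {s : ℕ × Ω → E p} {t : ℕ × Ω → E q}

lemma A8.tendsto_nSR [IsProbabilityMeasure P] (h8 : A8 𝒮 R θs b Sig) (hθs : θs ∈ M.Θ)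
    (htm : ∀ z, t z ∈ M.Θ) (ht : Tendsto t (inProb P) (𝓝 θs)) :
    Tendsto (fun z => 𝒮.nSR (R z.1) z.1 z.2 (t z)) (inProb P) (𝓝 (Sig θs)) := by
  have h1 : Tendsto (fun z => Sig (t z)) (inProb P) (𝓝 (Sig θs)) :=
    (h8.continuousOn θs hθs).tendsto.comp
      (tendsto_nhdsWithin_iff.2 ⟨ht, Eventually.of_forall htm⟩)
  refine tendsto_pi_nhds.2 fun i => tendsto_pi_nhds.2 fun j => ?_
  have h2 := (h8.cov_unif i j).tendsto_sub (Eventually.of_forall htm)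
  have h3 := h2.add (tendsto_pi_nhds.1 (tendsto_pi_nhds.1 h1 i) j)
  simpa using h3

/-- The residual of the adaptive indirect estimator is at most a constant times the residual at the
true parameter: the weights `(n S^R)⁻¹` are bounded at the true parameter, and bounded below on all
of `Θ` since `Sig` is bounded. -/
lemma exists_adi_residual_le [IsProbabilityMeasure P] (hθs : θs ∈ M.Θ)
    (hR : Tendsto R atTop atTop) (hadi : M.IsADI R adi) (h3 : A3 𝒮 b) (h8 : A8 𝒮 R θs b Sig)
    (hs : ∀ z, s z ∈ M.𝔹) (ht : ∀ z, t z = adi z.1 (s z) (𝒮.sim (R z.1) z.1 z.2)) :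
    ∃ C : ℝ, ∀ᶠ z in inProb P,
      ‖s z - 𝒮.mR (R z.1) z.1 z.2 (t z)‖ ≤ C * ‖s z - 𝒮.mR (R z.1) z.1 z.2 θs‖ := by
  obtain ⟨K, hK⟩ := exists_trace_le hR h3 h8
  have hpd := h8.posDef θs hθs
  have hudet : IsUnit (Sig θs).det := (Matrix.isUnit_iff_isUnit_det _).1 hpd.isUnit
  have hlim := h8.tendsto_nSR hθs (fun _ => hθs) tendsto_const_nhds
  obtain ⟨c, C, hc, hC, hev⟩ := eventually_wnorm_bounds (tendsto_matrix_inv hlim hudet) hpd.inv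
  have hu : ∀ᶠ z : ℕ × Ω in inProb P, IsUnit (𝒮.nSR (R z.1) z.1 z.2 θs).det := by
    have h1 := ((continuous_id.matrix_det).tendsto (Sig θs)).comp hlim
    filter_upwards [h1.eventually_ne hudet.ne_zero] with z hz
    exact isUnit_iff_ne_zero.2 hz
  have htr : ∀ᶠ z in inProb P, ∀ i, ∀ a ∈ M.Θ,
      dist (𝒮.nSR (R z.1) z.1 z.2 a i i) (Sig a i i) < 1 :=
    eventually_all.2 fun i => uniformlyInProb_iff.1 (h8.cov_unif i i) 1 one_pos
  refine ⟨|(K + p) * C| + 1, ?_⟩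
  filter_upwards [hev, hu, htr, tendsto_fst_inProb.eventually (eventually_ne_atTop 0),
    tendsto_fst_inProb.eventually (hR.eventually_ge_atTop 1)] with z h1 h2 h4 h5 h6
  have htm : t z ∈ M.Θ := by rw [ht]; exact hadi.mem _ _ (hs z) _
  obtain ⟨h7, h8'⟩ := hadi.isUnit_det_and_wnorm_le h5 (hs z) (𝒮.sim (R z.1) z.1 z.2) hθs h2
  rw [← ht z] at h7 h8'
  have htrace : (𝒮.nSR (R z.1) z.1 z.2 (t z)).trace ≤ K + p := by
    have h9 : (𝒮.nSR (R z.1) z.1 z.2 (t z)).trace - (Sig (t z)).trace ≤ p := by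
      rw [Matrix.trace, Matrix.trace, ← Finset.sum_sub_distrib]
      calc _ ≤ ∑ _i : Fin p, (1 : ℝ) := Finset.sum_le_sum fun i _ =>
            (le_abs_self _).trans (h4 i (t z) htm).le
        _ = p := by simp
    linarith [hK _ htm]
  have hform : ∀ x : E p, wnorm (𝒮.nSR (R z.1) z.1 z.2 (t z)) x ≤ (K + p) * ‖x‖ ^ 2 := by
    intro x
    refine le_trans ?_ (mul_le_mul_of_nonneg_right htrace (sq_nonneg _))
    change wnorm ((z.1 : ℝ) • sampleCov _) x ≤ ((z.1 : ℝ) • sampleCov _).trace * _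
    rw [wnorm_smul_left, Matrix.trace_smul, smul_eq_mul, mul_assoc]
    exact mul_le_mul_of_nonneg_left (wnorm_sampleCov_le h6 _ x) (by positivity)
  have hKp : 0 ≤ K + p := by
    refine le_trans ?_ htrace
    exact (posSemidef_smul_S h6 (𝒮.sim (R z.1) z.1 z.2) (t z)).trace_nonneg
  have h10 := sq_norm_le_mul_wnorm_inv
    (posSemidef_smul_S h6 (𝒮.sim (R z.1) z.1 z.2) (t z)) h7 hform
    (s z - M.m z.1 (𝒮.sim (R z.1) z.1 z.2) (t z))
  refine norm_le_mul_norm_of_sq_le (h10.trans ?_)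
  rw [mul_assoc]
  exact mul_le_mul_of_nonneg_left (h8'.trans (h1 _).2) hKp

lemma tendsto_adi [IsProbabilityMeasure P] (hθs : θs ∈ M.Θ)
    (hR : Tendsto R atTop atTop) (hadi : M.IsADI R adi) (h2 : A2 M θs ρinf b) (h3 : A3 𝒮 b)
    (h8 : A8 𝒮 R θs b Sig) (hs : ∀ z, s z ∈ M.𝔹) (hlim : Tendsto s (inProb P) (𝓝 (b θs)))
    (ht : ∀ z, t z = adi z.1 (s z) (𝒮.sim (R z.1) z.1 z.2)) :
    Tendsto t (inProb P) (𝓝 θs) := by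
  obtain ⟨C, hC⟩ := exists_adi_residual_le hθs hR hadi h3 h8 hs ht
  have htm : ∀ z, t z ∈ M.Θ := fun z => by rw [ht]; exact hadi.mem _ _ (hs z) _
  have hm : ∀ t' : ℕ × Ω → E q, (∀ z, t' z ∈ M.Θ) →
      Tendsto (fun z => (𝒮.mR (R z.1) z.1 z.2) (t' z) - b (t' z)) (inProb P) (𝓝 0) :=
    fun t' ht' => h8.mean_unif.tendsto_sub (Eventually.of_forall ht')
  exact tendsto_of_minimum_distance (l := inProb P) (m := fun z => 𝒮.mR (R z.1) z.1 z.2) (s := s)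
    (t := t) (b := b) (C := C) hθs h2.inverse_continuous htm hlim hm hC

/-- The adaptive indirect estimator at an arbitrary `√n`-consistent value `s` of the statistic is
asymptotically the weighted least squares transform of `s`. -/
lemma adi_linearization [IsProbabilityMeasure P] (hθs : θs ∈ M.Θ)
    (hR : Tendsto R atTop atTop) (hadi : M.IsADI R adi) (h2 : A2 M θs ρinf b) (h3 : A3 𝒮 b)
    (h8 : A8 𝒮 R θs b Sig) (h5 : A5 𝒮 θs b) (h9 : A9 𝒮 R θs b adi)
    (hs : ∀ z, s z ∈ M.𝔹) (hlim : Tendsto s (inProb P) (𝓝 (b θs)))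
    (ht : ∀ z, t z = adi z.1 (s z) (𝒮.sim (R z.1) z.1 z.2))
    (hOp : IsOp (inProb P) fun z => √(z.1 : ℝ) • (s z - b θs)) :
    Tendsto (fun z : ℕ × Ω => √(z.1 : ℝ) • (t z - θs) -
      act (wls (jacobian b θs) (Sig θs)⁻¹) (√(z.1 : ℝ) • (s z - b θs))) (inProb P) (𝓝 0) := by
  have htlim := tendsto_adi hθs hR hadi h2 h3 h8 hs hlim ht
  obtain ⟨C, hC⟩ := exists_adi_residual_le hθs hR hadi h3 h8 hs ht
  have htint : ∀ z, t z ∈ interior M.Θ := fun z => by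
    rw [ht]; exact h9.interiorValued _ _ (hs z) _
  have htm : ∀ z, t z ∈ M.Θ := fun z => interior_subset (htint z)
  have hpd := h8.posDef θs hθs
  have hudet : IsUnit (Sig θs).det := (Matrix.isUnit_iff_isUnit_det _).1 hpd.isUnit
  have hnS := h8.tendsto_nSR hθs htm htlim
  have hA := tendsto_matrix_inv hnS hudet
  have hstar := h8.mean_star.tendsto
  have hsm : IsOp (inProb P) fun z : ℕ × Ω => √(z.1 : ℝ) • (s z - 𝒮.mR (R z.1) z.1 z.2 θs) := by
    refine (hOp.sub (isOp_of_tendsto hstar)).congr' (Eventually.of_forall fun z => ?_)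
    simp only [← smul_sub]
    congr 1
    abel
  have hres : IsOp (inProb P) fun z : ℕ × Ω =>
      √(z.1 : ℝ) • (s z - 𝒮.mR (R z.1) z.1 z.2 (t z)) := by
    refine hsm.of_le C ?_
    filter_upwards [hC] with z hz
    rw [norm_smul, norm_smul, mul_left_comm]
    gcongr
  have hx0 : Tendsto (fun z : ℕ × Ω => s z - 𝒮.mR (R z.1) z.1 z.2 (t z)) (inProb P) (𝓝 0) := by
    refine squeeze_zero_norm' hC ?_
    have h := (tendsto_sub_nhds_zero_iff.2 hlim).sub
      (h8.mean_unif.tendsto_sub (t := fun _ => θs) (Eventually.of_forall fun _ => hθs))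
    simp only [sub_sub_sub_cancel_right, sub_zero] at h
    simpa using h.norm.const_mul C
  have hU : interior M.Θ ∈ 𝓝 θs := isOpen_interior.mem_nhds h5.mem_interior
  have hscore : Tendsto (fun z : ℕ × Ω => act (jacobian (𝒮.mR (R z.1) z.1 z.2) (t z))ᵀ
      (act (𝒮.nSR (R z.1) z.1 z.2 (t z))⁻¹
        (√(z.1 : ℝ) • (s z - 𝒮.mR (R z.1) z.1 z.2 (t z))))) (inProb P) (𝓝 0) := by
    simp only [act_smul (𝒮.nSR _ _ _ _)⁻¹]
    refine tendsto_score_of_foc (l := inProb P) (r := fun z => √(z.1 : ℝ))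
      (J := fun z => jacobian (𝒮.mR (R z.1) z.1 z.2) (t z))
      (y := fun z => act (𝒮.nSR (R z.1) z.1 z.2 (t z))⁻¹ (s z - 𝒮.mR (R z.1) z.1 z.2 (t z)))
      (D := fun z i j => fderiv ℝ (fun θ => 𝒮.nSR (R z.1) z.1 z.2 θ i j) (t z)) ?_ ?_
      (fun i j => (h9.cov_deriv (fun n ω => t (n, ω)) (toInProb_of_tendsto htlim) i j).isOp) ?_
    · simpa only [act_zero] using tendsto_act hA hx0
    · exact (hres.act hA).congr' (Eventually.of_forall fun z => act_smul _ _ _)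
    · have h1 := ((continuous_id.matrix_det).tendsto (Sig θs)).comp hnS
      filter_upwards [h1.eventually_ne hudet.ne_zero,
        tendsto_fst_inProb.eventually (eventually_ne_atTop 0),
        tendsto_fst_inProb.eventually (hR.eventually_ge_atTop 1)] with z h1 h6 h7 h
      exact hadi.foc h5 h6 h7 (hs z) _ (ht z) (htint z) (isUnit_iff_ne_zero.2 h1) h
  have hdiff : ∀ z : ℕ × Ω, ∀ θ ∈ interior M.Θ,
      DifferentiableAt ℝ (𝒮.mR (R z.1) z.1 z.2) θ := fun z θ hθ =>
    h5.differentiableAt_m z.1 (𝒮.sim (R z.1) z.1 z.2) hθ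
  have hder : ∀ ξ : ℕ × Ω → E q, Tendsto ξ (inProb P) (𝓝 θs) →
      Tendsto (fun z => fderiv ℝ (𝒮.mR (R z.1) z.1 z.2) (ξ z)) (inProb P) (𝓝 (fderiv ℝ b θs)) :=
    fun ξ hξ => (h9.mean_deriv (fun n ω => ξ (n, ω)) (toInProb_of_tendsto hξ)).tendsto
  have hmain := linearization_of_minimum_distance (l := inProb P)
    (m := fun z => 𝒮.mR (R z.1) z.1 z.2) (s := s) (t := t) (r := fun z => √(z.1 : ℝ))
    (A := fun z => (𝒮.nSR (R z.1) z.1 z.2 (t z))⁻¹) (b := b) (C := C) hU hpd.inv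
    (h2.rank_jacobian θs h5.mem_interior) hdiff hder hA htlim hsm hC hscore
  have h20 := tendsto_act (tendsto_const_nhds (x := wls (jacobian b θs) (Sig θs)⁻¹)) hstar
  rw [act_zero] at h20
  have h21 := hmain.sub h20
  rw [sub_zero] at h21
  refine h21.congr fun z => ?_
  simp only [act_smul, act_sub]
  module

end ADI

end Estimators

/-! ### Covariance matrices of linear transforms and of independent sums -/

section Covariance

variable {p q : ℕ} {Ω Ω' : Type*} [MeasurableSpace Ω] [MeasurableSpace Ω'] {P : Measure Ω}
  {P' : Measure Ω'}

lemma memLp_apply {X : Ω → E p} (hX : MemLp X 2 P) (i : Fin p) : MemLp (fun ω => X ω i) 2 P :=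
  (EuclideanSpace.proj (𝕜 := ℝ) i).comp_memLp' hX

lemma memLp_act {X : Ω → E p} (hX : MemLp X 2 P) (A : Matrix (Fin q) (Fin p) ℝ) :
    MemLp (fun ω => act A (X ω)) 2 P :=
  (matCLM A).comp_memLp' hX

lemma aestronglyMeasurable_apply (μ : Measure (E p)) (i : Fin p) :
    AEStronglyMeasurable (fun x : E p => x i) μ :=
  (EuclideanSpace.proj (𝕜 := ℝ) i).continuous.aestronglyMeasurable

lemma covMat_id_map {X : Ω → E p} (hX : AEMeasurable X P) :
    covMat (id : E p → E p) (P.map X) = covMat X P := by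
  ext i j
  exact covariance_map_fun (aestronglyMeasurable_apply _ i) (aestronglyMeasurable_apply _ j) hX

lemma memLp_id_map {X : Ω → E p} (hX : MemLp X 2 P) : MemLp (id : E p → E p) 2 (P.map X) :=
  (memLp_map_measure_iff aestronglyMeasurable_id hX.aestronglyMeasurable.aemeasurable).2 hX

lemma covMat_act [IsFiniteMeasure P] {X : Ω → E p} (hX : MemLp X 2 P)
    (A : Matrix (Fin q) (Fin p) ℝ) :
    covMat (fun ω => act A (X ω)) P = A * covMat X P * Aᵀ := by
  ext i j
  simp only [covMat, Matrix.of_apply, act_apply, Matrix.mul_apply, Matrix.transpose_apply]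
  rw [covariance_fun_sum_fun_sum (fun k => (memLp_apply hX k).const_mul _)
    (fun k => (memLp_apply hX k).const_mul _)]
  simp only [covariance_const_mul_left, covariance_const_mul_right, Finset.sum_mul]
  rw [Finset.sum_comm]
  refine Finset.sum_congr rfl fun k _ => Finset.sum_congr rfl fun k' _ => ?_
  ring

lemma covMat_const_smul (c : ℝ) (X : Ω → E p) :
    covMat (fun ω => c • X ω) P = c ^ 2 • covMat X P := by
  ext i j
  simp only [covMat, Matrix.of_apply, Matrix.smul_apply, PiLp.smul_apply, smul_eq_mul,
    covariance_const_mul_left, covariance_const_mul_right]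
  ring

lemma covMat_fst_add_snd [IsProbabilityMeasure P] [IsProbabilityMeasure P'] {X : Ω → E p}
    {Y : Ω' → E p} (hX : MemLp X 2 P) (hY : MemLp Y 2 P') :
    covMat (fun x : Ω × Ω' => X x.1 + Y x.2) (P.prod P') = covMat X P + covMat Y P' := by
  ext i j
  have hX1 : ∀ i, MemLp (fun x : Ω × Ω' => X x.1 i) 2 (P.prod P') :=
    fun i => (memLp_apply hX i).comp_fst P'
  have hY1 : ∀ i, MemLp (fun x : Ω × Ω' => Y x.2 i) 2 (P.prod P') :=
    fun i => (memLp_apply hY i).comp_snd P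
  have h1 : cov[fun x : Ω × Ω' => X x.1 i, fun x => X x.1 j; P.prod P'] =
      cov[fun ω => X ω i, fun ω => X ω j; P] := by
    have h := covariance_map_fun (μ := P.prod P') (Z := Prod.fst) (X := fun ω => X ω i)
      (Y := fun ω => X ω j)
      (by simpa using (memLp_apply hX i).aestronglyMeasurable)
      (by simpa using (memLp_apply hX j).aestronglyMeasurable) measurable_fst.aemeasurable
    rw [← h, Measure.map_fst_prod, measure_univ, one_smul]
  have h2 : cov[fun x : Ω × Ω' => Y x.2 i, fun x => Y x.2 j; P.prod P'] =
      cov[fun ω => Y ω i, fun ω => Y ω j; P'] := by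
    have h := covariance_map_fun (μ := P.prod P') (Z := Prod.snd) (X := fun ω => Y ω i)
      (Y := fun ω => Y ω j)
      (by simpa using (memLp_apply hY i).aestronglyMeasurable)
      (by simpa using (memLp_apply hY j).aestronglyMeasurable) measurable_snd.aemeasurable
    rw [← h, Measure.map_snd_prod, measure_univ, one_smul]
  have h3 : cov[fun x : Ω × Ω' => X x.1 i, fun x => Y x.2 j; P.prod P'] = 0 :=
    covariance_fst_snd_prod (memLp_apply hX i) (memLp_apply hY j)
  have h4 : cov[fun x : Ω × Ω' => Y x.2 i, fun x => X x.1 j; P.prod P'] = 0 := by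
    rw [covariance_comm]
    exact covariance_fst_snd_prod (memLp_apply hX j) (memLp_apply hY i)
  simp only [covMat, Matrix.of_apply, Matrix.add_apply, PiLp.add_apply]
  have h5 := covariance_add_left (hX1 i) (hY1 i) ((hX1 j).add (hY1 j))
  rw [covariance_add_right (hX1 i) (hX1 j) (hY1 j), covariance_add_right (hY1 i) (hX1 j) (hY1 j),
    h1, h2, h3, h4, add_zero, zero_add] at h5
  exact h5

end Covariance

/-! ### Limits of sums of independent sequences -/

section IndependentSums

variable {p : ℕ} {Ω : Type*} [MeasurableSpace Ω] {P : Measure Ω} [IsProbabilityMeasure P]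

/-- If `X n` and `Y n` are independent for each `n`, convergence in distribution of both implies
that of the pair, to the product of the limits. -/
lemma tendstoInDistribution_prodMk_of_indepFun {X Y : ℕ → Ω → E p} {L L' : Measure (E p)}
    [IsProbabilityMeasure L] [IsProbabilityMeasure L']
    (hX : TendstoInDistribution X atTop (id : E p → E p) (fun _ => P) L)
    (hY : TendstoInDistribution Y atTop (id : E p → E p) (fun _ => P) L')
    (hXY : ∀ n, IndepFun (X n) (Y n) P) :
    TendstoInDistribution (fun n ω => (X n ω, Y n ω)) atTop (id : E p × E p → E p × E p)
      (fun _ => P) (L.prod L') := by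
  refine ⟨fun n => (hX.forall_aemeasurable n).prodMk (hY.forall_aemeasurable n),
    aemeasurable_id, ?_⟩
  have h := (ProbabilityMeasure.continuous_prod.tendsto _).comp
    (hX.tendsto.prodMk_nhds hY.tendsto)
  refine (h.congr fun n => ?_).trans_eq ?_
  · apply Subtype.ext
    exact ((indepFun_iff_map_prod_eq_prod_map_map (hX.forall_aemeasurable n)
      (hY.forall_aemeasurable n)).1 (hXY n)).symm
  · congr 1
    apply Subtype.ext
    simp [ProbabilityMeasure.prod]

/-- Limits of linear combinations of independent sequences with a common limiting covariance. -/
lemma exists_limit_sum_of_iIndepFun {Z : ℕ → ℕ → Ω → E p} {V : Matrix (Fin p) (Fin p) ℝ}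
    (hm : ∀ r n, Measurable (Z r n)) (hind : ∀ n, iIndepFun (fun r => Z r n) P)
    (hZ : ∀ r, ∃ L : Measure (E p), ∃ _ : IsProbabilityMeasure L,
      TendstoInDistribution (Z r) atTop (id : E p → E p) (fun _ => P) L ∧
        MemLp (id : E p → E p) 2 L ∧ covMat id L = V) (a : ℕ → ℝ) (k : ℕ) :
    ∃ L : Measure (E p), ∃ _ : IsProbabilityMeasure L,
      TendstoInDistribution (fun n ω => ∑ r ∈ Finset.range k, a r • Z r n ω) atTop
        (id : E p → E p) (fun _ => P) L ∧ MemLp (id : E p → E p) 2 L ∧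
        covMat id L = (∑ r ∈ Finset.range k, a r ^ 2) • V := by
  induction k with
  | zero =>
    refine ⟨Measure.dirac 0, inferInstance, ?_, ?_, ?_⟩
    · refine ⟨fun n => by simp, aemeasurable_id, ?_⟩
      have : ∀ n : ℕ, (P.map fun ω : Ω => ∑ r ∈ Finset.range 0, a r • Z r n ω) =
          (Measure.dirac 0).map (id : E p → E p) := by
        intro n; simp
      simp only [this]
      exact tendsto_const_nhds
    · exact (memLp_const (0 : E p)).ae_eq (ae_eq_dirac (id : E p → E p)).symm
    · ext i j
      simp [covMat, covariance]
  | succ k ih =>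
    obtain ⟨L, hL, h1, h2, h3⟩ := ih
    obtain ⟨L', hL', h4, h5, h6⟩ := hZ k
    have hindep : ∀ n, IndepFun (fun ω => ∑ r ∈ Finset.range k, a r • Z r n ω) (Z k n) P := by
      intro n
      have hdisj : Disjoint (Finset.range k) {k} := by simp
      have hφ : Measurable fun x : Finset.range k → E p => ∑ i : Finset.range k, a i • x i :=
        Finset.measurable_fun_sum _ fun i _ => (measurable_pi_apply i).const_smul (a i)
      have hψ : Measurable fun x : ({k} : Finset ℕ) → E p => x ⟨k, Finset.mem_singleton_self k⟩ :=
        measurable_pi_apply _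
      have := ((hind n).indepFun_finset _ _ hdisj (fun r => hm r n)).comp hφ hψ
      convert this using 1
      · funext ω
        exact (Finset.sum_coe_sort (Finset.range k) fun i => a i • Z i n ω).symm
      · rfl
    have hpair := tendstoInDistribution_prodMk_of_indepFun h1 h4 hindep
    let g : E p × E p → E p := fun x => x.1 + a k • x.2
    have hg : Continuous g := by fun_prop
    have hgL : MemLp g 2 (L.prod L') := (h2.comp_fst L').add ((h5.comp_snd L).const_smul (a k))
    have hprob : IsProbabilityMeasure ((L.prod L').map g) :=
      Measure.isProbabilityMeasure_map hg.aemeasurable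
    refine ⟨(L.prod L').map g, hprob, ?_, memLp_id_map hgL, ?_⟩
    · have h7 := hpair.continuous_comp hg
      refine ⟨fun n => ?_, aemeasurable_id, ?_⟩
      · exact (Finset.measurable_fun_sum _ fun r _ => (hm r n).const_smul (a r)).aemeasurable
      · have h8 := h7.tendsto
        refine (h8.congr fun n => ?_).trans_eq ?_
        · apply Subtype.ext
          simp only [Function.comp_def, g, Finset.sum_range_succ]
        · congr 1
          apply Subtype.ext
          simp
    · rw [covMat_id_map hg.aemeasurable]
      have h9 := covMat_fst_add_snd h2 (h5.const_smul (a k))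
      have h10 := covMat_const_smul (P := L') (a k) (id : E p → E p)
      rw [Finset.sum_range_succ, add_smul, ← h3, ← h6, ← h10]
      exact h9

end IndependentSums

/-! ### The covariance matrix of linear unbiased limits -/

section LimitVariance

variable {p q : ℕ} {Ω Ω' : Type*} [MeasurableSpace Ω] {P : Measure Ω} [IsProbabilityMeasure P]

lemma tendstoInDistribution_act_of_tendsto_sub [MeasurableSpace Ω'] {P' : Measure Ω'}
    [IsProbabilityMeasure P'] {X : ℕ → Ω → E p} {V : Ω' → E p}
    (hX : TendstoInDistribution X atTop V (fun _ => P) P')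
    {Y : ℕ → Ω → E q} (D : Matrix (Fin q) (Fin p) ℝ) (hY : ∀ n, AEMeasurable (Y n) P)
    (h : Tendsto (fun z : ℕ × Ω => Y z.1 z.2 - act D (X z.1 z.2)) (inProb P) (𝓝 0)) :
    TendstoInDistribution Y atTop (fun v => act D (V v)) (fun _ => P) P' :=
  tendstoInDistribution_of_tendsto_sub
    (TendstoInDistribution.continuous_comp (g := act D) (continuous_act D) hX) h hY

lemma tendstoInDistribution_id_map [MeasurableSpace Ω'] {P' : Measure Ω'}
    [IsProbabilityMeasure P'] {Y : ℕ → Ω → E q} {V : Ω' → E q}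
    [IsProbabilityMeasure (P'.map V)]
    (h : TendstoInDistribution Y atTop V (fun _ => P) P') :
    TendstoInDistribution Y atTop (id : E q → E q) (fun _ => P) (P'.map V) := by
  refine ⟨h.forall_aemeasurable, aemeasurable_id, h.tendsto.trans_eq ?_⟩
  congr 1
  apply Subtype.ext
  simp

/-- A sequence that is asymptotically a linear unbiased transform `D X` of a sequence `X` whose
limit has covariance matrix `κ V`, `κ ≥ 1`, satisfies the Gauss–Markov bound. -/
lemma limitVarianceGE_of_linear {X : ℕ → Ω → E p} {Y : ℕ → Ω → E q} {L : Measure (E p)}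
    [IsProbabilityMeasure L] (hX : TendstoInDistribution X atTop (id : E p → E p) (fun _ => P) L)
    (hL : MemLp (id : E p → E p) 2 L) {κ : ℝ} (hκ : 1 ≤ κ) {V : Matrix (Fin p) (Fin p) ℝ}
    (hV : V.PosDef) (hcov : covMat id L = κ • V) {B : Matrix (Fin p) (Fin q) ℝ} (hB : B.rank = q)
    {D : Matrix (Fin q) (Fin p) ℝ} (hD : D * B = 1) (hY : ∀ n, AEMeasurable (Y n) P)
    (h : Tendsto (fun z : ℕ × Ω => Y z.1 z.2 - act D (X z.1 z.2)) (inProb P) (𝓝 0)) :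
    LimitVarianceGE (P := P) Y (Bᵀ * V⁻¹ * B)⁻¹ := by
  have hm : AEMeasurable (act D) L := (continuous_act D).aemeasurable
  have hprob : IsProbabilityMeasure (L.map (act D)) := Measure.isProbabilityMeasure_map hm
  have hact : MemLp (act D) 2 L := memLp_act hL D
  refine ⟨L.map (act D), hprob,
    tendstoInDistribution_id_map (tendstoInDistribution_act_of_tendsto_sub hX D hY h),
    memLp_id_map hact, ?_⟩
  have h1 : covMat (act D) L = D * covMat id L * Dᵀ := covMat_act hL D
  rw [covMat_id_map hm, h1, hcov]
  have h2 : D * κ • V * Dᵀ - (Bᵀ * V⁻¹ * B)⁻¹ =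
      (κ - 1) • (D * V * Dᵀ) + (D * V * Dᵀ - (Bᵀ * V⁻¹ * B)⁻¹) := by
    rw [Matrix.mul_smul, Matrix.smul_mul, sub_smul, one_smul]
    abel
  rw [h2]
  refine Matrix.PosSemidef.add (Matrix.PosSemidef.smul ?_ (by linarith))
    (posSemidef_gaussMarkov hB hV hD)
  simpa using hV.posSemidef.mul_mul_conjTranspose_same D

end LimitVariance

/-! ### The statistic as an M-estimator -/

section Statistic

variable {p q : ℕ} {M : Model.{u₁, u₂, u₃} p q} {Ω : Type u₄} [MeasurableSpace Ω]
  {P : Measure Ω} {𝒮 : M.Sampling P} {θs : E q} {ρinf : E p → E q → ℝ} {b : E q → E p}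
  {Sig : E q → Matrix (Fin p) (Fin p) ℝ} {R : ℕ → ℕ}

lemma A3.tendsto_sr (h3 : A3 𝒮 b) (r : ℕ) {θ : E q} (hθ : θ ∈ M.Θ) :
    Tendsto (fun z : ℕ × Ω => 𝒮.sr r z.1 z.2 θ) (inProb P) (𝓝 (b θ)) := by
  have h := (h3 r).tendsto_sub (t := fun _ => θ) (Eventually.of_forall fun _ => hθ)
  exact tendsto_sub_nhds_zero_iff.1 h

lemma A8.isOp_sr [IsProbabilityMeasure P] (h8 : A8 𝒮 R θs b Sig) (r : ℕ) {θ : E q}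
    (hθ : θ ∈ M.Θ) :
    IsOp (inProb P) (fun z : ℕ × Ω => √(z.1 : ℝ) • (𝒮.sr r z.1 z.2 θ - b θ)) := by
  obtain ⟨L, hL, h, -⟩ := h8.limit r θ hθ
  exact isOp_of_tendstoInDistribution
    (X := fun (n : ℕ) ω => √(n : ℝ) • (𝒮.sr r n ω θ - b θ)) h

lemma differentiableAt_gradient {f : E p → ℝ} {U : Set (E p)} (hU : IsOpen U)
    (hf : ContDiffOn ℝ 2 f U) {x : E p} (hx : x ∈ U) :
    DifferentiableAt ℝ (fun y => gradient f y) x := by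
  have h1 : ContDiffOn ℝ 1 (fderiv ℝ f) U := hf.fderiv_of_isOpen hU le_rfl
  have h2 := (h1.differentiableOn one_ne_zero).differentiableAt (hU.mem_nhds hx)
  exact ((InnerProductSpace.toDual ℝ (E p)).symm.differentiableAt).comp x h2

/-- The statistic is asymptotically linear in the scaled negative gradient of the criterion. -/
lemma statistic_linearization [IsProbabilityMeasure P] (hθs : θs ∈ M.Θ)
    (h2 : A2 M θs ρinf b) (h3 : A3 𝒮 b) (h7 : A7 𝒮 θs ρinf (b θs)) (h8 : A8 𝒮 R θs b Sig) :
    Tendsto (fun z : ℕ × Ω => √(z.1 : ℝ) • (𝒮.obs z.1 z.2 θs - b θs) -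
      act (hessian (fun β => ρinf β θs) (b θs))⁻¹ (√(z.1 : ℝ) • (-gradient
        (fun β => M.ρ z.1 β (M.G z.1 θs (𝒮.seed z.1 0 z.2).1) (𝒮.seed z.1 0 z.2).2) (b θs))))
      (inProb P) (𝓝 0) := by
  set J := hessian (fun β => ρinf β θs) (b θs) with hJ
  let f : ℕ × Ω → E p → E p := fun z y => gradient
    (fun β => M.ρ z.1 β (M.G z.1 θs (𝒮.seed z.1 0 z.2).1) (𝒮.seed z.1 0 z.2).2) y
  have hU : interior M.𝔹 ∈ 𝓝 (b θs) := isOpen_interior.mem_nhds h2.b_interior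
  have hf : ∀ z, ∀ x ∈ interior M.𝔹, DifferentiableAt ℝ (f z) x := fun z x hx =>
    differentiableAt_gradient isOpen_interior (h7.contDiffOn z.1 _ _) hx
  have hA : ∀ ξ : ℕ × Ω → E p, Tendsto ξ (inProb P) (𝓝 (b θs)) →
      Tendsto (fun z => fderiv ℝ (f z) (ξ z)) (inProb P) (𝓝 (matCLM J)) := by
    intro ξ hξ
    rw [hJ, hessian, matCLM_jacobian]
    exact tendsto_fderiv_of_jacobian fun i j =>
      (h7.tendsto_local (fun n ω => ξ (n, ω)) (toInProb_of_tendsto hξ) i j).tendsto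
  have hs : Tendsto (fun z : ℕ × Ω => 𝒮.obs z.1 z.2 θs) (inProb P) (𝓝 (b θs)) :=
    h3.tendsto_sr 0 hθs
  obtain ⟨δ, hδ, hlin⟩ := exists_linearization hU hf hA hs
  -- The statistic is an interior minimizer, so the gradient vanishes there.
  have hzero : ∀ z : ℕ × Ω, f z (𝒮.obs z.1 z.2 θs) = 0 := by
    intro z
    have hmin : IsLocalMin
        (fun β => M.ρ z.1 β (M.G z.1 θs (𝒮.seed z.1 0 z.2).1) (𝒮.seed z.1 0 z.2).2)
        (𝒮.obs z.1 z.2 θs) :=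
      (M.stat_min z.1 _ _).isLocalMin
        (mem_interior_iff_mem_nhds.1 (h2.stat_interior z.1 _ _))
    simp only [f, gradient, hmin.fderiv_eq_zero, map_zero]
  have hOp := h8.isOp_sr 0 hθs
  have hrem : Tendsto (fun z : ℕ × Ω => √(z.1 : ℝ) •
      (f z (𝒮.obs z.1 z.2 θs) - f z (b θs) - matCLM J (𝒮.obs z.1 z.2 θs - b θs)))
      (inProb P) (𝓝 0) := by
    refine hOp.tendsto_zero_of_le hδ ?_
    filter_upwards [hlin] with z hz
    rw [norm_smul, norm_smul, mul_left_comm]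
    exact mul_le_mul_of_nonneg_left hz (norm_nonneg _)
  have h := (tendsto_act (tendsto_const_nhds (x := J⁻¹)) hrem).neg
  rw [act_zero, neg_zero] at h
  refine h.congr fun z => ?_
  have hinv : act J⁻¹ (act J (𝒮.obs z.1 z.2 θs - b θs)) = 𝒮.obs z.1 z.2 θs - b θs := by
    rw [← act_mul, Matrix.nonsing_inv_mul _ h7.isUnit, act_one]
  rw [hzero, zero_sub, act_smul, act_sub, matCLM_apply, hinv, act_smul, ← smul_neg, ← smul_sub,
    neg_sub]

/-! ### Local perturbations of the true parameter -/

lemma tendsto_local_parameter {h : ℕ → E q} {h₀ : E q} (hh : Tendsto h atTop (𝓝 h₀)) :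
    Tendsto (fun n : ℕ => θs + (√(n : ℝ))⁻¹ • h n) atTop (𝓝 θs) := by
  have h1 : Tendsto (fun n : ℕ => (√(n : ℝ))⁻¹) atTop (𝓝 0) :=
    (Real.tendsto_sqrt_atTop.comp tendsto_natCast_atTop_atTop).inv_tendsto_atTop
  simpa using (h1.smul hh).const_add θs

/-- Expansion of a random function along the local parameters `θs + h n / √n`. -/
lemma tendsto_sqrt_smul_sub_of_local {f : ℕ × Ω → E q → E p} {U : Set (E q)} (hU : U ∈ 𝓝 θs)
    (hf : ∀ z, ∀ x ∈ U, DifferentiableAt ℝ (f z) x) {A : E q →L[ℝ] E p}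
    (hA : ∀ ξ : ℕ × Ω → E q, Tendsto ξ (inProb P) (𝓝 θs) →
      Tendsto (fun z => fderiv ℝ (f z) (ξ z)) (inProb P) (𝓝 A))
    {h : ℕ → E q} {h₀ : E q} (hh : Tendsto h atTop (𝓝 h₀)) :
    Tendsto (fun z : ℕ × Ω =>
      √(z.1 : ℝ) • (f z (θs + (√(z.1 : ℝ))⁻¹ • h z.1) - f z θs) - A (h z.1)) (inProb P) (𝓝 0) := by
  have hy : Tendsto (fun z : ℕ × Ω => θs + (√(z.1 : ℝ))⁻¹ • h z.1) (inProb P) (𝓝 θs) :=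
    (tendsto_local_parameter hh).comp tendsto_fst_inProb
  obtain ⟨δ, hδ, hlin⟩ := exists_linearization hU hf hA hy
  have hh' : Tendsto (fun z : ℕ × Ω => h z.1) (inProb P) (𝓝 h₀) := hh.comp tendsto_fst_inProb
  refine (isOp_of_tendsto hh').tendsto_zero_of_le hδ ?_
  filter_upwards [hlin, tendsto_fst_inProb.eventually (eventually_ge_atTop 1)] with z hz hn
  have hpos : 0 < √(z.1 : ℝ) := Real.sqrt_pos.2 (by exact_mod_cast hn)
  rw [add_sub_cancel_left] at hz
  have h1 : √(z.1 : ℝ) • (f z (θs + (√(z.1 : ℝ))⁻¹ • h z.1) - f z θs) - A (h z.1) =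
      √(z.1 : ℝ) • (f z (θs + (√(z.1 : ℝ))⁻¹ • h z.1) - f z θs - A ((√(z.1 : ℝ))⁻¹ • h z.1)) := by
    rw [smul_sub _ (_ - _), ← map_smul, smul_smul, mul_inv_cancel₀ hpos.ne', one_smul]
  rw [h1, norm_smul, Real.norm_eq_abs, abs_of_pos hpos]
  calc √(z.1 : ℝ) * _ ≤ √(z.1 : ℝ) * (δ z * ‖(√(z.1 : ℝ))⁻¹ • h z.1‖) := by gcongr
    _ = δ z * ‖h z.1‖ := by
        rw [norm_smul, norm_inv, Real.norm_eq_abs, abs_of_pos hpos]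
        field_simp

lemma A5.tendsto_sqrt_smul_obs_sub (h5 : A5 𝒮 θs b) {h : ℕ → E q} {h₀ : E q}
    (hh : Tendsto h atTop (𝓝 h₀)) :
    Tendsto (fun z : ℕ × Ω => √(z.1 : ℝ) •
      (𝒮.obs z.1 z.2 (θs + (√(z.1 : ℝ))⁻¹ • h z.1) - 𝒮.obs z.1 z.2 θs) -
        fderiv ℝ b θs (h z.1)) (inProb P) (𝓝 0) :=
  tendsto_sqrt_smul_sub_of_local (f := fun z => 𝒮.obs z.1 z.2)
    (isOpen_interior.mem_nhds h5.mem_interior)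
    (fun z _ hx => h5.differentiableAt_s z.1 (𝒮.seed z.1 0 z.2) hx)
    (fun ξ hξ => (h5.tendsto_local 0 (fun n ω => ξ (n, ω)) (toInProb_of_tendsto hξ)).tendsto) hh

lemma A5.tendsto_sqrt_smul_b_sub (h5 : A5 𝒮 θs b) {h : ℕ → E q} {h₀ : E q}
    (hh : Tendsto h atTop (𝓝 h₀)) :
    Tendsto (fun z : ℕ × Ω => √(z.1 : ℝ) •
      (b (θs + (√(z.1 : ℝ))⁻¹ • h z.1) - b θs) - fderiv ℝ b θs (h z.1)) (inProb P) (𝓝 0) := by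
  have hU := isOpen_interior.mem_nhds h5.mem_interior
  refine tendsto_sqrt_smul_sub_of_local (f := fun _ => b) hU
    (fun z x hx => (h5.contDiffOn_b.differentiableOn one_ne_zero).differentiableAt
      (isOpen_interior.mem_nhds hx)) (fun ξ hξ => ?_) hh
  exact ((h5.contDiffOn_b.continuousOn_fderiv_of_isOpen isOpen_interior le_rfl).continuousAt
    hU).tendsto.comp hξ

/-- Under the local parameters `θs + h n / √n` the statistic, centred at the binding function, is
asymptotically equivalent to the statistic at `θs`. -/
lemma A5.tendsto_obs_local_sub (h5 : A5 𝒮 θs b) {h : ℕ → E q} {h₀ : E q}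
    (hh : Tendsto h atTop (𝓝 h₀)) :
    Tendsto (fun z : ℕ × Ω => √(z.1 : ℝ) • (𝒮.obs z.1 z.2 (θs + (√(z.1 : ℝ))⁻¹ • h z.1) -
        b (θs + (√(z.1 : ℝ))⁻¹ • h z.1)) - √(z.1 : ℝ) • (𝒮.obs z.1 z.2 θs - b θs))
      (inProb P) (𝓝 0) := by
  have h1 := (h5.tendsto_sqrt_smul_obs_sub hh).sub (h5.tendsto_sqrt_smul_b_sub hh)
  rw [sub_zero] at h1
  refine h1.congr fun z => ?_
  module

/-- Under the local parameters `θs + h n / √n` the adaptive indirect estimator, centred at the true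
parameter, is asymptotically the same linear transform of the statistic at `θs` as under `θs`. -/
lemma adi_local_linearization [IsProbabilityMeasure P]
    {adi : ∀ n, E p → (Fin (R n) → M.Seed n) → E q}
    (hθs : θs ∈ M.Θ) (hR : Tendsto R atTop atTop) (hadi : M.IsADI R adi) (h2 : A2 M θs ρinf b)
    (h3 : A3 𝒮 b) (h8 : A8 𝒮 R θs b Sig) (h5 : A5 𝒮 θs b) (h9 : A9 𝒮 R θs b adi)
    {h : ℕ → E q} {h₀ : E q} (hh : Tendsto h atTop (𝓝 h₀))
    (hmem : ∀ n : ℕ, θs + (√(n : ℝ))⁻¹ • h n ∈ M.Θ) :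
    Tendsto (fun z : ℕ × Ω =>
      √(z.1 : ℝ) • (𝒮.eval adi z.1 z.2 (θs + (√(z.1 : ℝ))⁻¹ • h z.1) -
          (θs + (√(z.1 : ℝ))⁻¹ • h z.1)) -
        act (wls (jacobian b θs) (Sig θs)⁻¹) (√(z.1 : ℝ) • (𝒮.obs z.1 z.2 θs - b θs)))
      (inProb P) (𝓝 0) := by
  set y : ℕ × Ω → E q := fun z => θs + (√(z.1 : ℝ))⁻¹ • h z.1 with hy
  have hylim : Tendsto y (inProb P) (𝓝 θs) :=
    (tendsto_local_parameter hh).comp tendsto_fst_inProb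
  have hym : ∀ z, y z ∈ M.Θ := fun z => hmem z.1
  have hblim : Tendsto (fun z => b (y z)) (inProb P) (𝓝 (b θs)) :=
    (h2.continuousOn θs hθs).tendsto.comp
      (tendsto_nhdsWithin_iff.2 ⟨hylim, Eventually.of_forall hym⟩)
  have hlim : Tendsto (fun z => 𝒮.obs z.1 z.2 (y z)) (inProb P) (𝓝 (b θs)) := by
    have h1 := (UniformlyInProb.tendsto_sub (h3 0) (Eventually.of_forall hym)).add hblim
    rw [zero_add] at h1
    exact h1.congr fun z => sub_add_cancel _ _
  have hexp := h5.tendsto_sqrt_smul_obs_sub hh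
  have hderiv : Tendsto (fun z : ℕ × Ω => fderiv ℝ b θs (h z.1)) (inProb P)
      (𝓝 (fderiv ℝ b θs h₀)) :=
    ((fderiv ℝ b θs).continuous.tendsto h₀).comp (hh.comp tendsto_fst_inProb)
  have hOp : IsOp (inProb P) fun z : ℕ × Ω => √(z.1 : ℝ) • (𝒮.obs z.1 z.2 (y z) - b θs) := by
    refine (((isOp_of_tendsto hexp).add (isOp_of_tendsto hderiv)).add
      (h8.isOp_sr 0 hθs)).congr' (Eventually.of_forall fun z => ?_)
    change _ - _ + _ + √(z.1 : ℝ) • (𝒮.obs z.1 z.2 θs - b θs) = _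
    simp only [hy]
    module
  have hlin := adi_linearization (s := fun z => 𝒮.obs z.1 z.2 (y z))
    (t := fun z => 𝒮.eval adi z.1 z.2 (y z)) hθs hR hadi h2 h3 h8 h5 h9
    (fun z => 𝒮.obs_mem _ _ _) hlim (fun z => rfl) hOp
  have hexp2 := tendsto_act (tendsto_const_nhds (x := wls (jacobian b θs) (Sig θs)⁻¹)) hexp
  rw [act_zero] at hexp2
  have h1 := hlin.add hexp2
  rw [add_zero] at h1
  refine h1.congr' ?_
  filter_upwards [tendsto_fst_inProb.eventually (eventually_ge_atTop 1)] with z hn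
  have hpos : 0 < √(z.1 : ℝ) := Real.sqrt_pos.2 (by exact_mod_cast hn)
  have hW : act (wls (jacobian b θs) (Sig θs)⁻¹) (fderiv ℝ b θs (h z.1)) = h z.1 := by
    rw [← act_jacobian, ← act_mul, wls_mul_self (h2.rank_jacobian θs h5.mem_interior)
      (h8.posDef θs hθs).inv, act_one]
  have hyz : √(z.1 : ℝ) • y z = √(z.1 : ℝ) • θs + h z.1 := by
    simp only [hy]
    rw [smul_add, smul_smul, mul_inv_cancel₀ hpos.ne', one_smul]
  simp only [act_smul, act_sub, hW]
  rw [smul_sub _ _ (y z), hyz]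
  simp only [hy]
  module

/-! ### Estimators of the form `ψ(s)` -/

/-- A consistent estimator `ψ(s)` inverts the binding function wherever `ψ` is continuous. -/
lemma WellBehaved.apply_b [IsProbabilityMeasure P] {βs : E p} {ψ : E p → E q}
    (hψ : WellBehaved 𝒮 βs ψ) (h3 : A3 𝒮 b) {θ : E q} (hθ : θ ∈ M.Θ)
    (hc : ContinuousAt ψ (b θ)) : ψ (b θ) = θ :=
  tendsto_nhds_unique (hc.tendsto.comp (h3.tendsto_sr 0 hθ)) (hψ.consistent θ hθ).tendsto

/-- Differentiating `ψ (b θ) = θ` at `θs`: the Jacobian matrix of a consistent `ψ` is a left inverse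
of that of the binding function. -/
lemma WellBehaved.jacobian_mul [IsProbabilityMeasure P] {ψ : E p → E q}
    (hψ : WellBehaved 𝒮 (b θs) ψ) (h3 : A3 𝒮 b) (h5 : A5 𝒮 θs b) :
    jacobian ψ (b θs) * jacobian b θs = 1 := by
  have hU := isOpen_interior.mem_nhds h5.mem_interior
  have hb : DifferentiableAt ℝ b θs :=
    (h5.contDiffOn_b.differentiableOn one_ne_zero).differentiableAt hU
  have hψd : DifferentiableAt ℝ ψ (b θs) := hψ.contDiffAt.differentiableAt one_ne_zero
  have hid : ∀ᶠ θ in 𝓝 θs, ψ (b θ) = θ := by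
    have h1 : ∀ᶠ β in 𝓝 (b θs), ContinuousAt ψ β :=
      (hψ.contDiffAt.eventually (by simp)).mono fun β hβ => hβ.continuousAt
    filter_upwards [hb.continuousAt.eventually h1, hU] with θ h2 h4
    exact hψ.apply_b h3 (interior_subset h4) h2
  have hcomp : HasFDerivAt (fun θ => ψ (b θ)) ((fderiv ℝ ψ (b θs)).comp (fderiv ℝ b θs)) θs :=
    hψd.hasFDerivAt.comp θs hb.hasFDerivAt
  have hcomp2 : HasFDerivAt (fun θ => ψ (b θ)) (ContinuousLinearMap.id ℝ (E q)) θs :=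
    (hasFDerivAt_id θs).congr_of_eventuallyEq hid
  have heq := hcomp.unique hcomp2
  ext i j
  have h1 := congrArg (fun L : E q →L[ℝ] E q => L (EuclideanSpace.single j 1) i) heq
  simp only [ContinuousLinearMap.comp_apply, ← act_jacobian, ← act_mul,
    ContinuousLinearMap.id_apply] at h1
  simpa [act_apply, Matrix.one_apply, Pi.single_apply] using h1

lemma WellBehaved.linearization [IsProbabilityMeasure P] {ψ : E p → E q} (hθs : θs ∈ M.Θ)
    (hψ : WellBehaved 𝒮 (b θs) ψ) (h3 : A3 𝒮 b) (h8 : A8 𝒮 R θs b Sig) :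
    Tendsto (fun z : ℕ × Ω => √(z.1 : ℝ) • (ψ (𝒮.obs z.1 z.2 θs) - θs) -
      act (jacobian ψ (b θs)) (√(z.1 : ℝ) • (𝒮.obs z.1 z.2 θs - b θs))) (inProb P) (𝓝 0) := by
  have hψb : ψ (b θs) = θs := hψ.apply_b h3 hθs hψ.contDiffAt.continuousAt
  have hd : HasFDerivAt ψ (fderiv ℝ ψ (b θs)) (b θs) :=
    (hψ.contDiffAt.differentiableAt one_ne_zero).hasFDerivAt
  have hs : Tendsto (fun z : ℕ × Ω => 𝒮.obs z.1 z.2 θs) (inProb P) (𝓝 (b θs)) :=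
    h3.tendsto_sr 0 hθs
  have hOp := h8.isOp_sr 0 hθs
  rw [hasFDerivAt_iff_tendsto] at hd
  have hδ := hd.comp hs
  refine hOp.tendsto_zero_of_le hδ (Eventually.of_forall fun z => ?_)
  rw [act_smul, act_jacobian, ← smul_sub, norm_smul, norm_smul, Function.comp_apply, hψb]
  rcases eq_or_ne (‖𝒮.obs z.1 z.2 θs - b θs‖) 0 with h0 | h0
  · have h1 : 𝒮.obs z.1 z.2 θs = b θs := sub_eq_zero.1 (norm_eq_zero.1 h0)
    simp [h1, hψb]
  · refine le_of_eq ?_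
    change _ = _ * (‖√(z.1 : ℝ)‖ * ‖𝒮.obs z.1 z.2 θs - b θs‖)
    field_simp

end Statistic

/-! ### The indirect estimator with deterministic weights -/

section IND

variable {p q : ℕ} {M : Model.{u₁, u₂, u₃} p q} {Ω : Type u₄} [MeasurableSpace Ω]
  {P : Measure Ω} {𝒮 : M.Sampling P} {θs : E q} {ρinf : E p → E q → ℝ} {b : E q → E p}
  {Sig : E q → Matrix (Fin p) (Fin p) ℝ} {R : ℕ → ℕ} {R₀ : ℕ}
  {Wt : ℕ → Matrix (Fin p) (Fin p) ℝ} {W : Matrix (Fin p) (Fin p) ℝ}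
  {ind : ∀ n, E p → (Fin R₀ → M.Seed n) → E q}

lemma Model.Sampling.mR_sub (𝒮 : M.Sampling P) (hR₀ : R₀ ≠ 0) (n : ℕ) (ω : Ω) (θ : E q) (c : E p) :
    𝒮.mR R₀ n ω θ - c = ∑ r : Fin R₀, (R₀ : ℝ)⁻¹ • (𝒮.sr (r + 1) n ω θ - c) := by
  rw [← Finset.smul_sum]
  exact sampleMean_sub_const hR₀ _ c

lemma A3.tendsto_mR_sub (h3 : A3 𝒮 b) (hR₀ : R₀ ≠ 0) {t : ℕ × Ω → E q} (ht : ∀ z, t z ∈ M.Θ) :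
    Tendsto (fun z : ℕ × Ω => 𝒮.mR R₀ z.1 z.2 (t z) - b (t z)) (inProb P) (𝓝 0) := by
  have h := tendsto_finsetSum (Finset.univ : Finset (Fin R₀)) fun r _ =>
    (UniformlyInProb.tendsto_sub (h3 (r + 1)) (Eventually.of_forall ht)).const_smul (R₀ : ℝ)⁻¹
  simp only [smul_zero, Finset.sum_const_zero] at h
  exact h.congr fun z => (𝒮.mR_sub hR₀ _ _ _ _).symm

lemma A5.tendsto_fderiv_mR (h5 : A5 𝒮 θs b) (hR₀ : R₀ ≠ 0) {ξ : ℕ × Ω → E q}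
    (hξ : Tendsto ξ (inProb P) (𝓝 θs)) :
    Tendsto (fun z : ℕ × Ω => fderiv ℝ (𝒮.mR R₀ z.1 z.2) (ξ z)) (inProb P)
      (𝓝 (fderiv ℝ b θs)) := by
  have h : Tendsto (fun z : ℕ × Ω => (R₀ : ℝ)⁻¹ • ∑ r : Fin R₀,
      fderiv ℝ (𝒮.sr (r + 1) z.1 z.2) (ξ z)) (inProb P)
      (𝓝 ((R₀ : ℝ)⁻¹ • ∑ _r : Fin R₀, fderiv ℝ b θs)) :=
    (tendsto_finsetSum (Finset.univ : Finset (Fin R₀)) fun r _ =>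
      (h5.tendsto_local (r + 1) (fun n ω => ξ (n, ω))
        (toInProb_of_tendsto hξ)).tendsto).const_smul (R₀ : ℝ)⁻¹
  rw [Finset.sum_const, Finset.card_univ, Fintype.card_fin, ← Nat.cast_smul_eq_nsmul ℝ, smul_smul,
    inv_mul_cancel₀ (by exact_mod_cast hR₀), one_smul] at h
  refine h.congr' ?_
  filter_upwards [hξ (isOpen_interior.mem_nhds h5.mem_interior)] with z hz
  have hr : ∀ r : Fin R₀, HasFDerivAt (𝒮.sr (r + 1) z.1 z.2)
      (fderiv ℝ (𝒮.sr (r + 1) z.1 z.2) (ξ z)) (ξ z) := fun r =>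
    (h5.differentiableAt_s z.1 (𝒮.seed z.1 (r + 1) z.2) hz).hasFDerivAt
  have hsum : HasFDerivAt (fun θ => ∑ r : Fin R₀, 𝒮.sr (r + 1) z.1 z.2 θ)
      (∑ r : Fin R₀, fderiv ℝ (𝒮.sr (r + 1) z.1 z.2) (ξ z)) (ξ z) :=
    HasFDerivAt.fun_sum fun r _ => hr r
  have hd : HasFDerivAt (𝒮.mR R₀ z.1 z.2) ((R₀ : ℝ)⁻¹ • ∑ r : Fin R₀,
      fderiv ℝ (𝒮.sr (r + 1) z.1 z.2) (ξ z)) (ξ z) := hsum.const_smul (R₀ : ℝ)⁻¹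
  exact hd.fderiv.symm

lemma exists_ind_residual_le (hθs : θs ∈ M.Θ) (h4 : A4 Wt W) (hind : M.IsIND R₀ Wt ind)
    {s : ℕ × Ω → E p} (hs : ∀ z, s z ∈ M.𝔹) :
    ∃ C : ℝ, ∀ᶠ z in inProb P,
      ‖s z - 𝒮.mR R₀ z.1 z.2 (ind z.1 (s z) (𝒮.sim R₀ z.1 z.2))‖ ≤
        C * ‖s z - 𝒮.mR R₀ z.1 z.2 θs‖ := by
  obtain ⟨c, C, hc, hC, hev⟩ :=
    eventually_wnorm_bounds (h4.tendsto.comp (tendsto_fst_inProb (P := P))) h4.posDef_lim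
  refine ⟨|c * C| + 1, ?_⟩
  filter_upwards [hev] with z hz
  refine norm_le_mul_norm_of_sq_le ((hz _).1.trans ?_)
  rw [mul_assoc]
  exact mul_le_mul_of_nonneg_left
    ((hind.isMin z.1 _ (hs z) (𝒮.sim R₀ z.1 z.2) hθs).trans (hz _).2) hc.le

/-- The indirect estimator is asymptotically the weighted least squares transform of the difference
between the observed statistic and the mean of the simulated ones. -/
lemma ind_linearization [IsProbabilityMeasure P] (hθs : θs ∈ M.Θ) (hR₀ : R₀ ≠ 0) (h4 : A4 Wt W)
    (hind : M.IsIND R₀ Wt ind) (hint : M.InteriorValued (R := fun _ => R₀) ind)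
    (h2 : A2 M θs ρinf b) (h3 : A3 𝒮 b) (h8 : A8 𝒮 R θs b Sig) (h5 : A5 𝒮 θs b) :
    Tendsto (fun z : ℕ × Ω =>
      √(z.1 : ℝ) • (𝒮.eval (R := fun _ => R₀) ind z.1 z.2 θs - θs) -
        act (wls (jacobian b θs) W) (√(z.1 : ℝ) • (𝒮.obs z.1 z.2 θs - 𝒮.mR R₀ z.1 z.2 θs)))
      (inProb P) (𝓝 0) := by
  set s : ℕ × Ω → E p := fun z => 𝒮.obs z.1 z.2 θs with hs
  set t : ℕ × Ω → E q := fun z => ind z.1 (s z) (𝒮.sim R₀ z.1 z.2) with ht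
  have hsm : ∀ z, s z ∈ M.𝔹 := fun z => 𝒮.obs_mem _ _ _
  have hslim : Tendsto s (inProb P) (𝓝 (b θs)) := h3.tendsto_sr 0 hθs
  have htint : ∀ z, t z ∈ interior M.Θ := fun z => hint z.1 _ (hsm z) _
  have htm : ∀ z, t z ∈ M.Θ := fun z => interior_subset (htint z)
  obtain ⟨C, hC⟩ := exists_ind_residual_le (P := P) (𝒮 := 𝒮) hθs h4 hind hsm
  have htlim : Tendsto t (inProb P) (𝓝 θs) :=
    tendsto_of_minimum_distance (l := inProb P) (m := fun z => 𝒮.mR R₀ z.1 z.2) (s := s)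
      (t := t) (b := b) (C := C) hθs h2.inverse_continuous htm hslim
      (fun t' ht' => h3.tendsto_mR_sub hR₀ ht') hC
  have hmOp : IsOp (inProb P) fun z : ℕ × Ω => √(z.1 : ℝ) • (𝒮.mR R₀ z.1 z.2 θs - b θs) := by
    have h : ∀ T : Finset (Fin R₀), IsOp (inProb P) fun z : ℕ × Ω =>
        ∑ r ∈ T, (R₀ : ℝ)⁻¹ • (√(z.1 : ℝ) • (𝒮.sr (r + 1) z.1 z.2 θs - b θs)) := by
      intro T
      induction T using Finset.induction_on with
      | empty =>
        simp only [Finset.sum_empty]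
        exact isOp_of_tendsto tendsto_const_nhds
      | insert r T hr ih =>
        simp only [Finset.sum_insert hr]
        refine IsOp.add ?_ ih
        exact (h8.isOp_sr (r + 1) hθs).of_le ‖(R₀ : ℝ)⁻¹‖
          (Eventually.of_forall fun z => (norm_smul _ _).le)
    refine (h Finset.univ).congr' (Eventually.of_forall fun z => ?_)
    change _ = √(z.1 : ℝ) • (𝒮.mR R₀ z.1 z.2 θs - b θs)
    rw [𝒮.mR_sub hR₀, Finset.smul_sum]
    exact Finset.sum_congr rfl fun r _ => smul_comm _ _ _
  have hsOp : IsOp (inProb P) fun z : ℕ × Ω => √(z.1 : ℝ) • (s z - 𝒮.mR R₀ z.1 z.2 θs) := by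
    refine ((h8.isOp_sr 0 hθs).sub hmOp).congr' (Eventually.of_forall fun z => ?_)
    change √(z.1 : ℝ) • (s z - b θs) - _ = _
    module
  have hdiff : ∀ z : ℕ × Ω, ∀ θ ∈ interior M.Θ, DifferentiableAt ℝ (𝒮.mR R₀ z.1 z.2) θ :=
    fun z θ hθ => h5.differentiableAt_m z.1 (𝒮.sim R₀ z.1 z.2) hθ
  have hA : Tendsto (fun z : ℕ × Ω => Wt z.1) (inProb P) (𝓝 W) :=
    h4.tendsto.comp tendsto_fst_inProb
  have hscore : ∀ z : ℕ × Ω, act (jacobian (𝒮.mR R₀ z.1 z.2) (t z))ᵀ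
      (act (Wt z.1) (√(z.1 : ℝ) • (s z - 𝒮.mR R₀ z.1 z.2 (t z)))) = 0 := by
    intro z
    have hpd := h4.posDef z.1
    have hu : IsUnit (Wt z.1).det := (Matrix.isUnit_iff_isUnit_det _).1 hpd.isUnit
    have hui : IsUnit (Wt z.1)⁻¹.det := (Matrix.isUnit_iff_isUnit_det _).1 hpd.inv.isUnit
    have hmin : IsLocalMin (fun θ => wnorm (Wt z.1)⁻¹⁻¹ (s z - 𝒮.mR R₀ z.1 z.2 θ)) (t z) := by
      rw [Matrix.nonsing_inv_nonsing_inv _ hu]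
      exact (hind.isMin z.1 _ (hsm z) (𝒮.sim R₀ z.1 z.2)).isLocalMin
        (mem_interior_iff_mem_nhds.1 (htint z))
    refine ext_inner_left ℝ fun v => ?_
    have hsc := score_of_isLocalMin (S := fun _ => (Wt z.1)⁻¹)
      (x := fun θ => s z - 𝒮.mR R₀ z.1 z.2 θ) (fun _ _ => differentiableAt_const _)
      ((hdiff z _ (htint z)).const_sub (s z)) hui (Eventually.of_forall fun _ => hpd.inv.posSemidef)
      hmin v
    rw [Matrix.nonsing_inv_nonsing_inv _ hu] at hsc
    simp only [fderiv_const_sub, fderiv_fun_const, Pi.zero_apply, _root_.zero_apply, zero_mul,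
      mul_zero, Finset.sum_const_zero, _root_.neg_apply, inner_neg_left] at hsc
    rw [act_smul, act_smul, real_inner_smul_right, inner_act, Matrix.transpose_transpose,
      act_jacobian, inner_zero_right]
    have : inner ℝ (fderiv ℝ (𝒮.mR R₀ z.1 z.2) (t z) v)
        (act (Wt z.1) (s z - 𝒮.mR R₀ z.1 z.2 (t z))) = 0 := by linarith
    rw [this, mul_zero]
  exact linearization_of_minimum_distance (l := inProb P)
    (m := fun z => 𝒮.mR R₀ z.1 z.2) (s := s) (t := t) (r := fun z => √(z.1 : ℝ))
    (A := fun z => Wt z.1) (b := b) (C := C) (isOpen_interior.mem_nhds h5.mem_interior)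
    h4.posDef_lim (h2.rank_jacobian θs h5.mem_interior) hdiff
    (fun ξ hξ => h5.tendsto_fderiv_mR hR₀ hξ) hA htlim hsOp hC
    (tendsto_const_nhds.congr fun z => (hscore z).symm)

/-- The observed statistic minus the mean of `R₀` simulated ones converges, at rate `√n`, to a limit
with covariance matrix `(1 + 1 / R₀) Sig θs`. -/
lemma exists_limit_obs_sub_mR [IsProbabilityMeasure P] (hθs : θs ∈ M.Θ) (hR₀ : R₀ ≠ 0)
    (h8 : A8 𝒮 R θs b Sig) :
    ∃ L : Measure (E p), ∃ _ : IsProbabilityMeasure L,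
      TendstoInDistribution (fun (n : ℕ) ω => √(n : ℝ) • (𝒮.obs n ω θs - 𝒮.mR R₀ n ω θs)) atTop
        (id : E p → E p) (fun _ => P) L ∧ MemLp (id : E p → E p) 2 L ∧
        covMat id L = (1 + (R₀ : ℝ)⁻¹) • Sig θs := by
  -- The difference is the combination of the statistics `sr r` with weights `1, -1/R₀, …, -1/R₀`.
  let a : ℕ → ℝ := fun r => if r = 0 then 1 else -(R₀ : ℝ)⁻¹
  let Z : ℕ → ℕ → Ω → E p := fun r n ω => √(n : ℝ) • (𝒮.sr r n ω θs - b θs)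
  have hm : ∀ r n, Measurable (Z r n) := fun r n =>
    ((𝒮.measurable_sr r n hθs).sub_const (b θs)).const_smul (√(n : ℝ))
  have hindep : ∀ n, iIndepFun (fun r => Z r n) P := fun n =>
    (𝒮.indep_seed n).comp (fun _ x => √(n : ℝ) • (M.s n x θs - b θs))
      fun _ => ((M.measurable_s n hθs).sub_const (b θs)).const_smul (√(n : ℝ))
  obtain ⟨L, hL, h1, h2, h3⟩ :=
    exists_limit_sum_of_iIndepFun hm hindep (fun r => h8.limit r θs hθs) a (R₀ + 1)
  have hR₀' : (R₀ : ℝ) ≠ 0 := by exact_mod_cast hR₀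
  refine ⟨L, hL, ?_, h2, ?_⟩
  · convert h1 using 3 with n ω
    rw [Finset.sum_range_succ', Finset.sum_range fun k => a (k + 1) • Z (k + 1) n ω]
    have h4 := 𝒮.mR_sub hR₀ n ω θs (b θs)
    have h5 : ∑ r : Fin R₀, a (r + 1) • Z (r + 1) n ω =
        -(√(n : ℝ) • (𝒮.mR R₀ n ω θs - b θs)) := by
      rw [h4, Finset.smul_sum, ← Finset.sum_neg_distrib]
      refine Finset.sum_congr rfl fun r _ => ?_
      simp only [a, Z, if_neg (Nat.succ_ne_zero _)]
      module
    rw [h5]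
    simp only [a, Z, if_pos, one_smul]
    change _ = _ + √(n : ℝ) • (𝒮.obs n ω θs - b θs)
    module
  · rw [h3, Finset.sum_range_succ']
    simp only [a, if_neg (Nat.succ_ne_zero _), if_pos, Finset.sum_const, Finset.card_range,
      nsmul_eq_mul]
    congr 1
    field_simp
    ring

end IND

section Measurability

variable {p q : ℕ} {M : Model.{u₁, u₂, u₃} p q} {Ω : Type u₄} [MeasurableSpace Ω]
  {P : Measure Ω} {R : ℕ → ℕ}

lemma Model.Sampling.measurable_eval (𝒮 : M.Sampling P)
    {est : ∀ n, E p → (Fin (R n) → M.Seed n) → E q} {n : ℕ}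
    (hest : Measurable fun y : E p × (Fin (R n) → M.Seed n) => est n y.1 y.2) {θ : E q}
    (hθ : θ ∈ M.Θ) : Measurable fun ω => 𝒮.eval est n ω θ :=
  hest.comp ((𝒮.measurable_sr 0 n hθ).prodMk
    (measurable_pi_lambda _ fun r => 𝒮.measurable_seed n (r + 1)))

end Measurability

end IndirectInference

end

/-! ### The asymptotic theory of the adaptive indirect estimator -/

theorem mainTheorem1 {p q : ℕ} (M : Model.{u₁, u₂, u₃} p q)
    {Ω : Type u₄} [MeasurableSpace Ω] (P : Measure Ω) [IsProbabilityMeasure P]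
    (𝒮 : M.Sampling P)
    (θs : E q) (hθs : θs ∈ M.Θ) (ρinf : E p → E q → ℝ) (b : E q → E p)
    (F : Measure (E p)) [IsProbabilityMeasure F]
    (Sig : E q → Matrix (Fin p) (Fin p) ℝ)
    (R : ℕ → ℕ) (hR : Tendsto R atTop atTop)
    (adi : ∀ n, E p → (Fin (R n) → M.Seed n) → E q) (hadi : M.IsADI R adi)
    (h1 : A1 𝒮 θs ρinf) (h2 : A2 M θs ρinf b) (h3 : A3 𝒮 b) (h6 : A6 𝒮 θs (b θs) F)
    (h7 : A7 𝒮 θs ρinf (b θs)) (h8 : A8 𝒮 R θs b Sig) :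
    -- part 1
    ToInProb P (fun n ω => 𝒮.eval adi n ω θs) θs ∧
    (A5 𝒮 θs b → A9 𝒮 R θs b adi →
      -- part 2
      (MemLp (act (hessian (fun β => ρinf β θs) (b θs))⁻¹) 2 F ∧
        Sig θs = covMat (act (hessian (fun β => ρinf β θs) (b θs))⁻¹) F ∧
        TendstoInDistribution
          (fun (n : ℕ) ω => √(n : ℝ) • (𝒮.eval adi n ω θs - θs)) atTop
          (fun v => act (wls (jacobian b θs) (Sig θs)⁻¹)
            (act (hessian (fun β => ρinf β θs) (b θs))⁻¹ v))
          (fun _ => P) F) ∧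
      -- part 3
      (AsymptoticallyEquivariant (P := P) M.Θ θs (fun n ω θ => 𝒮.eval adi n ω θ) id ∧
        AsymptoticallyEquivariant (P := P) M.Θ θs 𝒮.obs b) ∧
      -- part 4
      (covMat (fun v => act (wls (jacobian b θs) (Sig θs)⁻¹)
            (act (hessian (fun β => ρinf β θs) (b θs))⁻¹ v)) F
          = ((jacobian b θs)ᵀ * (Sig θs)⁻¹ * jacobian b θs)⁻¹ ∧
        (∀ ψ : E p → E q, WellBehaved 𝒮 (b θs) ψ →
          LimitVarianceGE (P := P)
            (fun (n : ℕ) ω => √(n : ℝ) • (ψ (𝒮.obs n ω θs) - θs))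
            ((jacobian b θs)ᵀ * (Sig θs)⁻¹ * jacobian b θs)⁻¹) ∧
        (∀ (R₀ : ℕ) (Wt : ℕ → Matrix (Fin p) (Fin p) ℝ) (W : Matrix (Fin p) (Fin p) ℝ)
          (ind : ∀ n, E p → (Fin R₀ → M.Seed n) → E q),
          1 ≤ R₀ → A4 Wt W → M.IsIND R₀ Wt ind → M.InteriorValued (R := fun _ => R₀) ind →
          LimitVarianceGE (P := P)
            (fun (n : ℕ) ω => √(n : ℝ) • (𝒮.eval (R := fun _ => R₀) ind n ω θs - θs))
            ((jacobian b θs)ᵀ * (Sig θs)⁻¹ * jacobian b θs)⁻¹))) := by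
  have hobs : ∀ n θ, θ ∈ M.Θ → Measurable fun ω => 𝒮.obs n ω θ := fun n θ hθ =>
    𝒮.measurable_sr 0 n hθ
  have hslim : Tendsto (fun z : ℕ × Ω => 𝒮.obs z.1 z.2 θs) (inProb P) (𝓝 (b θs)) :=
    h3.tendsto_sr 0 hθs
  have hcons : Tendsto (fun z : ℕ × Ω => 𝒮.eval adi z.1 z.2 θs) (inProb P) (𝓝 θs) :=
    tendsto_adi (s := fun z => 𝒮.obs z.1 z.2 θs) (t := fun z => 𝒮.eval adi z.1 z.2 θs)
      hθs hR hadi h2 h3 h8 (fun z => 𝒮.obs_mem _ _ _) hslim (fun z => rfl)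
  refine ⟨toInProb_iff_tendsto.2 hcons, fun h5 h9 => ?_⟩
  set J := hessian (fun β => ρinf β θs) (b θs) with hJ
  set B := jacobian b θs with hBdef
  have hB : B.rank = q := h2.rank_jacobian θs h5.mem_interior
  have hV : (Sig θs).PosDef := h8.posDef θs hθs
  let X : ℕ → Ω → E p := fun n ω => √(n : ℝ) • (𝒮.obs n ω θs - b θs)
  have hXm : ∀ n, AEMeasurable (X n) P := fun n =>
    (((hobs n θs hθs).sub_const (b θs)).const_smul (√(n : ℝ))).aemeasurable
  have hXF : TendstoInDistribution X atTop (fun v => act J⁻¹ v) (fun _ => P) F :=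
    tendstoInDistribution_act_of_tendsto_sub h6.tendsto J⁻¹ hXm
      (statistic_linearization hθs h2 h3 h7 h8)
  obtain ⟨L, hL, hXL, hLmem, hLcov⟩ :
      ∃ L : Measure (E p), ∃ _ : IsProbabilityMeasure L,
        TendstoInDistribution X atTop (id : E p → E p) (fun _ => P) L ∧
          MemLp (id : E p → E p) 2 L ∧ covMat id L = Sig θs := h8.limit 0 θs hθs
  have hJm : AEMeasurable (act J⁻¹ : E p → E p) F := (continuous_act J⁻¹).aemeasurable
  -- Both descriptions of the limit of the statistic agree, by uniqueness of limits in law.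
  have hFL : F.map (act J⁻¹) = L := by
    have h := tendstoInDistribution_unique X hXF hXL
    rwa [Measure.map_id] at h
  have hmemF : MemLp (act J⁻¹ : E p → E p) 2 F := by
    rw [← hFL] at hLmem
    exact (memLp_map_measure_iff aestronglyMeasurable_id hJm).1 hLmem
  have hcovF : Sig θs = covMat (act J⁻¹ : E p → E p) F := by
    rw [← hLcov, ← hFL, covMat_id_map hJm]
  have hADIm : ∀ n θ, θ ∈ M.Θ → Measurable fun ω => 𝒮.eval adi n ω θ := fun n θ hθ =>
    𝒮.measurable_eval (hadi.measurable n) hθ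
  have hsmul : ∀ {k : ℕ} (n : ℕ) (c : E k) {Y : Ω → E k}, Measurable Y →
      AEMeasurable (fun ω => √(n : ℝ) • (Y ω - c)) P := fun n c Y hY =>
    ((hY.sub_const c).const_smul (√(n : ℝ))).aemeasurable
  refine ⟨⟨hmemF, hcovF, ?_⟩, ⟨?_, ?_⟩, ?_, ?_, ?_⟩
  · exact tendstoInDistribution_act_of_tendsto_sub
      (Y := fun (n : ℕ) ω => √(n : ℝ) • (𝒮.eval adi n ω θs - θs)) hXF _
      (fun n => hsmul n θs (hADIm n θs hθs))
      (adi_linearization (s := fun z => 𝒮.obs z.1 z.2 θs) (t := fun z => 𝒮.eval adi z.1 z.2 θs)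
        hθs hR hadi h2 h3 h8 h5 h9 (fun z => 𝒮.obs_mem _ _ _) hslim (fun z => rfl)
        (h8.isOp_sr 0 hθs))
  · have hprob : IsProbabilityMeasure (L.map (act (wls B (Sig θs)⁻¹))) :=
      Measure.isProbabilityMeasure_map (continuous_act _).aemeasurable
    refine ⟨L.map (act (wls B (Sig θs)⁻¹)), hprob, fun h h₀ hh hmem => ?_⟩
    exact tendstoInDistribution_id_map (V := act (wls B (Sig θs)⁻¹))
      (tendstoInDistribution_act_of_tendsto_sub hXL _
        (fun n => hsmul n _ (hADIm n _ (hmem n)))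
        (adi_local_linearization hθs hR hadi h2 h3 h8 h5 h9 hh hmem))
  · refine ⟨L, hL, fun h h₀ hh hmem => ?_⟩
    exact tendstoInDistribution_of_tendsto_sub hXL (h5.tendsto_obs_local_sub hh)
      (fun n => hsmul n _ (hobs n _ (hmem n)))
  · rw [covMat_act hmemF, ← hcovF, wls_mul_mul_wls_transpose hB hV]
  · intro ψ hψ
    exact limitVarianceGE_of_linear hXL hLmem le_rfl hV (by rw [hLcov, one_smul]) hB
      (hψ.jacobian_mul h3 h5) (fun n => hsmul n θs (hψ.measurable.comp (hobs n θs hθs)))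
      (hψ.linearization hθs h3 h8)
  · intro R₀ Wt W ind hR₀ h4 hind hint
    have hR₀' : R₀ ≠ 0 := Nat.one_le_iff_ne_zero.1 hR₀
    obtain ⟨L', hL', hXL', hLmem', hLcov'⟩ := exists_limit_obs_sub_mR hθs hR₀' h8
    exact limitVarianceGE_of_linear
      (Y := fun (n : ℕ) ω => √(n : ℝ) • (𝒮.eval (R := fun _ => R₀) ind n ω θs - θs))
      hXL' hLmem' (le_add_of_nonneg_right (inv_nonneg.2 (Nat.cast_nonneg R₀))) hV hLcov' hB
      (wls_mul_self hB h4.posDef_lim)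
      (fun n => hsmul n θs (𝒮.measurable_eval (R := fun _ => R₀) (hind.measurable n) hθs))
      (ind_linearization hθs hR₀' h4 hind hint h2 h3 h8 h5)
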